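/- Let $\mathbb{F}_q$ be a finite field, $A=\mathbb{F}_q[T]$, and let $K$ be a nonarchimedean local field with valuation ring $R$, maximal ideal $\mathfrak{p}$ and residue field $\mathbb{F}_\mathfrak{p}=R/\mathfrak{p}$, equipped with a ring homomorphism $\gamma:A\to K$ with $\gamma(A)\subseteq R$. Let $K\{\tau\}$ be the ring of twisted polynomials over $K$, with $\tau c=c^q\tau$ for $c\in K$. A Drinfeld module over $K$ of rank $r\ge 1$ is a ring homomorphism $\phi:A\to K\{\tau\}$, $a\mapsto\phi_a=\gamma(a)+\sum_{i=1}^{r\deg a}g_i(a)\tau^i$, with $g_r(T)\neq 0$. An isogeny $u:\phi\to\psi$ is a nonzero $u\in K\{\tau\}$ with $u\phi_a=\psi_a u$ for all $a\in A$; it is an isomorphism if $u$ is a unit of $K\{\tau\}$. We say that $\phi$ has stable reduction if there is a ring homomorphism $\phi':A\to R\{\tau\}$ which, viewed over $K$, is a Drinfeld module isomorphic to $\phi$ over $K$, and whose reduction modulo $\mathfrak{p}$ is a Drinfeld module (of some rank $\geq 1$) over $\mathbb{F}_\mathfrak{p}$. For a nonzero prime ideal $\mathfrak{l}=(l)$ of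 $A$ with $\gamma(l)\ne 0$, let $A_\mathfrak{l}$ be the completion of $A$ at $\mathfrak{l}$, let $F_\mathfrak{l}$ be its fraction field, let $T_\mathfrak{l}(\phi)=\varprojlim_n\phi[\mathfrak{l}^n]$ be the Tate module, where $\phi[\mathfrak{l}^n]\subseteq K^{\mathrm{sep}}$ is the set of zeros of $\phi_{l^n}$, and let $V_\mathfrak{l}(\phi)=T_\mathfrak{l}(\phi)\otimes_{A_\mathfrak{l}}F_\mathfrak{l}$, with its action of $\mathrm{Gal}(K^{\mathrm{sep}}/K)$. Let $I_\mathfrak{p}\subseteq\mathrm{Gal}(K^{\mathrm{sep}}/K)$ be the inertia group. Let $u:\phi\to\psi$ be an isogeny between Drinfeld modules over $K$. Let $\mathfrak{l}$ be a nonzero prime ideal of $A$ different from the kernel of the composite $A\to R\to\mathbb{F}_\mathfrak{p}$ (the $A$-characteristic of the reduction). If every element of $I_\mathfrak{p}$ acts on $V_\mathfrak{l}(\phi)$ as a unipotent endomorphism, then $\psi$ has stable reduction. -/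

import Mathlib

open Polynomial ValuativeRel
open scoped TensorProduct

noncomputable section

/-! ### Twisted polynomials

Throughout, `Fq` is a finite field with `q` elements and `A = Fq[X]`. An `A`-field (or `A`-ring) is a
field (or commutative ring) `S` with `[Algebra Fq[X] S]`; the structure map `γ` is the algebra map. -/

section Twisted

variable (Fq : Type*) [Field Fq] [Finite Fq]

theorem add_pow_natCard_pow (S : Type*) [CommRing S] [Algebra Fq[X] S] (n : ℕ) (x y : S) :
    (x + y) ^ (Nat.card Fq ^ n) = x ^ (Nat.card Fq ^ n) + y ^ (Nat.card Fq ^ n) := by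
  obtain ⟨p, hp⟩ := CharP.exists Fq
  have := Fintype.ofFinite Fq
  obtain ⟨m, hpp, hm⟩ := FiniteField.card Fq p
  rcases subsingleton_or_nontrivial S with h | h
  · exact Subsingleton.elim _ _
  have : Fact p.Prime := ⟨hpp⟩
  have : CharP S p :=
    charP_of_injective_ringHom (f := (algebraMap Fq[X] S).comp C) (RingHom.injective _) p
  rw [Nat.card_eq_fintype_card, hm, ← pow_mul]
  exact add_pow_char_pow x y p _

/-- The action of `ℕ` on an `A`-ring through powers of the `q`-Frobenius: `n` acts by
`x ↦ x ^ (q ^ n)`. -/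
@[reducible]
def frobeniusAction (S : Type*) [CommRing S] [Algebra Fq[X] S] :
    MulSemiringAction (Multiplicative ℕ) S where
  smul n x := x ^ (Nat.card Fq ^ n.toAdd)
  one_smul x := by
    change x ^ (Nat.card Fq ^ 0) = x
    simp
  mul_smul m n x := by
    change x ^ (Nat.card Fq ^ (m.toAdd + n.toAdd)) =
      (x ^ (Nat.card Fq ^ n.toAdd)) ^ (Nat.card Fq ^ m.toAdd)
    rw [← pow_mul, ← pow_add, add_comm]
  smul_zero n := by
    change (0 : S) ^ (Nat.card Fq ^ n.toAdd) = 0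
    exact zero_pow (pow_ne_zero _ Nat.card_pos.ne')
  smul_add n x y := add_pow_natCard_pow Fq S n.toAdd x y
  smul_one n := by
    change (1 : S) ^ (Nat.card Fq ^ n.toAdd) = 1
    simp
  smul_mul n x y := by
    change (x * y) ^ (Nat.card Fq ^ n.toAdd) = _
    rw [mul_pow]
    rfl

/-- The twisted polynomial ring `S{τ}`, with `τ * c = c ^ q * τ`. -/
def TwistedPoly (S : Type*) [CommRing S] [Algebra Fq[X] S] : Type _ := SkewPolynomial S

namespace TwistedPoly

variable {S : Type*} [CommRing S] [Algebra Fq[X] S]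

instance : Ring (TwistedPoly Fq S) :=
  letI := frobeniusAction Fq S
  inferInstanceAs (Ring (SkewPolynomial S))

variable {Fq}

/-- The coefficient of `τ ^ n` (coefficients are written on the left). -/
def coeff (f : TwistedPoly Fq S) (n : ℕ) : S := SkewPolynomial.coeff (R := S) f n

variable (Fq S) in
/-- The action of twisted polynomials on an extension `L` of `S`: the element `∑ cₙ τⁿ` acts as the
additive endomorphism `x ↦ ∑ cₙ x ^ (q ^ n)` (see `evalHom_apply`). -/
def evalHom (L : Type*) [CommRing L] [Algebra Fq[X] L] [Algebra S L] :
    TwistedPoly Fq S →+* AddMonoid.End L :=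
  letI := frobeniusAction Fq S
  letI := frobeniusAction Fq L
  SkewMonoidAlgebra.liftNCRingHom (k := S) (G := Multiplicative ℕ)
    ((Module.toAddMonoidEnd L L).comp (algebraMap S L))
    (DistribMulAction.toAddMonoidEnd (Multiplicative ℕ) L)
    (by
      intro x n
      ext z
      change algebraMap S L (x ^ (Nat.card Fq ^ n.toAdd)) * z ^ (Nat.card Fq ^ n.toAdd) =
        (algebraMap S L x * z) ^ (Nat.card Fq ^ n.toAdd)
      rw [mul_pow, map_pow])

theorem evalHom_apply (L : Type*) [CommRing L] [Algebra Fq[X] L] [Algebra S L]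
    (f : TwistedPoly Fq S) (x : L) :
    evalHom Fq S L f x = ∑ n ∈ SkewPolynomial.support (R := S) f,
      algebraMap S L (f.coeff n) * x ^ (Nat.card Fq ^ n) := by
  let := frobeniusAction Fq S
  let := frobeniusAction Fq L
  have h : evalHom Fq S L f =
      ∑ n ∈ SkewMonoidAlgebra.support (k := S) (G := Multiplicative ℕ) f,
        Module.toAddMonoidEnd L L
            (algebraMap S L (SkewMonoidAlgebra.coeff (k := S) (G := Multiplicative ℕ) f n)) *
          DistribMulAction.toAddMonoidEnd (Multiplicative ℕ) L n := rfl
  refine (DFunLike.congr_fun h x).trans ((map_sum (AddMonoidHom.eval x) _ _).trans ?_)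
  exact (Finset.sum_map _ ⟨Multiplicative.toAdd, Multiplicative.toAdd.injective⟩
    fun n => algebraMap S L (f.coeff n) * x ^ (Nat.card Fq ^ n)).symm

end TwistedPoly

end Twisted

/-! ### Tate modules -/

section Tate

variable {A : Type*} [CommRing A] (l : A) (M : Type*) [AddCommGroup M] [Module A M]

/-- The `l`-adic Tate module of an `A`-module `M`: the inverse limit of the torsion modules
`M[lⁿ]` along the maps `M[lⁿ⁺¹] → M[lⁿ]` given by multiplication by `l`. -/
def TateModule : Submodule A (ℕ → M) where
  carrier := {x | x 0 = 0 ∧ ∀ n, l • x (n + 1) = x n}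
  zero_mem' := ⟨rfl, fun _ => smul_zero _⟩
  add_mem' := by
    rintro x y ⟨hx, hx'⟩ ⟨hy, hy'⟩
    exact ⟨by simp [hx, hy], fun n => by simp [hx', hy']⟩
  smul_mem' := by
    rintro a x ⟨hx, hx'⟩
    exact ⟨by simp [hx], fun n => by simp [smul_comm l a, hx']⟩

namespace TateModule

variable {l M}

theorem pow_smul_apply (x : TateModule l M) (n : ℕ) : l ^ n • x.1 n = 0 := by
  induction n with
  | zero => simpa using x.2.1
  | succ n ih => rw [pow_succ, mul_smul, x.2.2, ih]

theorem smul_apply_congr (x : TateModule l M) (n : ℕ) {a b : A}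
    (h : Ideal.Quotient.mk (Ideal.span {l} ^ n) a = Ideal.Quotient.mk (Ideal.span {l} ^ n) b) :
    a • x.1 n = b • x.1 n := by
  rw [Ideal.Quotient.eq, Ideal.span_singleton_pow, Ideal.mem_span_singleton'] at h
  obtain ⟨c, hc⟩ := h
  rw [← sub_eq_zero, ← sub_smul, ← hc, mul_smul, pow_smul_apply, smul_zero]

/-- The action of the completion `A_l = lim A / lⁿ` on the Tate module: `(aₙ) • (xₙ) = (aₙ • xₙ)`,
where `aₙ ∈ A / lⁿ` acts on `xₙ ∈ M[lⁿ]` through any representative. -/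
instance : SMul (AdicCompletion (Ideal.span {l}) A) (TateModule l M) where
  smul a x := ⟨fun n => (AdicCompletion.evalₐ (Ideal.span {l}) n a).out • x.1 n,
    by simp [x.2.1], fun n => by
      rw [smul_comm, x.2.2]
      apply smul_apply_congr
      obtain ⟨b, rfl⟩ := AdicCompletion.mk_surjective _ _ a
      have h := Ideal.Quotient.mk_out (AdicCompletion.evalₐ (Ideal.span {l}) (n + 1)
        (AdicCompletion.mk _ _ b))
      refine Eq.trans ?_ (Eq.trans (AdicCompletion.Ideal.mk_eq_mk (Ideal.span {l}) n.le_succ b)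
        ((Ideal.Quotient.mk_out _).trans (AdicCompletion.evalₐ_mk _ n b)).symm)
      exact (Ideal.Quotient.eq).2 (Ideal.pow_le_pow_right n.le_succ
        ((Ideal.Quotient.eq).1 (h.trans (AdicCompletion.evalₐ_mk _ (n + 1) b))))⟩

theorem completion_smul_apply (a : AdicCompletion (Ideal.span {l}) A) (x : TateModule l M) (n : ℕ)
    {b : A} (h : AdicCompletion.evalₐ (Ideal.span {l}) n a = Ideal.Quotient.mk _ b) :
    (a • x).1 n = b • x.1 n :=
  smul_apply_congr x n ((Ideal.Quotient.mk_out _).trans h)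

instance : Module (AdicCompletion (Ideal.span {l}) A) (TateModule l M) where
  one_smul x := Subtype.ext <| funext fun n => by
    rw [completion_smul_apply 1 x n (b := 1) (by simp), one_smul]
  mul_smul a b x := Subtype.ext <| funext fun n => by
    obtain ⟨r, hr⟩ := Ideal.Quotient.mk_surjective (AdicCompletion.evalₐ (Ideal.span {l}) n a)
    obtain ⟨s, hs⟩ := Ideal.Quotient.mk_surjective (AdicCompletion.evalₐ (Ideal.span {l}) n b)
    rw [completion_smul_apply (a * b) x n (b := r * s) (by simp [hr, hs]),
      completion_smul_apply a _ n hr.symm, completion_smul_apply b x n hs.symm, mul_smul]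
  smul_zero a := Subtype.ext <| funext fun n => smul_zero _
  smul_add a x y := Subtype.ext <| funext fun n => smul_add _ _ _
  add_smul a b x := Subtype.ext <| funext fun n => by
    obtain ⟨r, hr⟩ := Ideal.Quotient.mk_surjective (AdicCompletion.evalₐ (Ideal.span {l}) n a)
    obtain ⟨s, hs⟩ := Ideal.Quotient.mk_surjective (AdicCompletion.evalₐ (Ideal.span {l}) n b)
    change _ = (a • x).1 n + (b • x).1 n
    rw [completion_smul_apply (a + b) x n (b := r + s) (by simp [hr, hs]),
      completion_smul_apply a _ n hr.symm, completion_smul_apply b x n hs.symm, add_smul]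
  zero_smul x := Subtype.ext <| funext fun n => by
    rw [completion_smul_apply 0 x n (b := 0) (by simp), zero_smul]
    rfl

variable {N : Type*} [AddCommGroup N] [Module A N]

/-- The map of Tate modules induced by an `A`-linear map. -/
def map (f : M →ₗ[A] N) :
    TateModule l M →ₗ[AdicCompletion (Ideal.span {l}) A] TateModule l N where
  toFun x := ⟨fun n => f (x.1 n), by simp [x.2.1], fun n => by rw [← map_smul, x.2.2]⟩
  map_add' x y := Subtype.ext <| funext fun n => map_add f _ _
  map_smul' a x := Subtype.ext <| funext fun n => map_smul f _ _

end TateModule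

/-- The rational Tate module `V_l = T_l ⊗ F_l`, where `F_l` is the fraction field of the completion
`A_l`. -/
abbrev RationalTateModule : Type _ :=
  FractionRing (AdicCompletion (Ideal.span {l}) A) ⊗[AdicCompletion (Ideal.span {l}) A]
    TateModule l M

end Tate

/-! ### Drinfeld modules -/

section Drinfeld

variable (Fq : Type*) [Field Fq] [Finite Fq]

/-- A Drinfeld `Fq[X]`-module over an `Fq[X]`-field `K`. -/
structure DrinfeldModule (K : Type*) [Field K] [Algebra Fq[X] K] where
  /-- The ring homomorphism `a ↦ φ_a`. -/
  toRingHom : Fq[X] →+* TwistedPoly Fq K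
  /-- The rank `r`. -/
  rank : ℕ
  one_le_rank : 1 ≤ rank
  coeff_zero : ∀ a, (toRingHom a).coeff 0 = algebraMap Fq[X] K a
  coeff_eq_zero : ∀ a n, rank * a.natDegree < n → (toRingHom a).coeff n = 0
  coeff_rank_ne_zero : (toRingHom X).coeff rank ≠ 0

namespace DrinfeldModule

variable {Fq} {K : Type*} [Field K] [Algebra Fq[X] K]

/-- `u` is an isogeny from `φ` to `ψ`. -/
def IsIsogeny (φ ψ : DrinfeldModule Fq K) (u : TwistedPoly Fq K) : Prop :=
  u ≠ 0 ∧ ∀ a, u * φ.toRingHom a = ψ.toRingHom a * u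

/-- `φ` and `ψ` are isomorphic over `K`. -/
def IsIsomorphic (φ ψ : DrinfeldModule Fq K) : Prop :=
  ∃ u : TwistedPoly Fq K, IsUnit u ∧ ∀ a, u * φ.toRingHom a = ψ.toRingHom a * u

/-- The `Fq[X]`-module `ᵠL`: the additive group of an extension `L` of `K`, on which `a` acts through
`φ_a`. -/
def Points (_φ : DrinfeldModule Fq K) (L : Type*) : Type _ := L

section Points

variable (φ : DrinfeldModule Fq K) (L : Type*) [Field L] [Algebra Fq[X] L] [Algebra K L]

instance : AddCommGroup (φ.Points L) := inferInstanceAs (AddCommGroup L)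

instance : Module Fq[X] (φ.Points L) :=
  letI : Module (AddMonoid.End L) (φ.Points L) := inferInstanceAs (Module (AddMonoid.End L) L)
  Module.compHom (φ.Points L) ((TwistedPoly.evalHom Fq K L).comp φ.toRingHom)

theorem points_smul_def (a : Fq[X]) (x : φ.Points L) :
    a • x = (TwistedPoly.evalHom Fq K L (φ.toRingHom a) x : L) := rfl

variable {L} in
/-- A `K`-automorphism of `L` commutes with the action of `Fq[X]` on `ᵠL`. -/
def galoisMap (σ : L ≃ₐ[K] L) : φ.Points L →ₗ[Fq[X]] φ.Points L where
  toFun x := σ x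
  map_add' x y := map_add σ x y
  map_smul' a x := by
    have key (f : TwistedPoly Fq K) (y : L) :
        σ (TwistedPoly.evalHom Fq K L f y) = TwistedPoly.evalHom Fq K L f (σ y) := by
      simp [TwistedPoly.evalHom_apply]
    exact key (φ.toRingHom a) x

end Points

/-- The rational `l`-adic representation of `Gal(Kˢᵉᵖ/K)` on `V_l(φ)`. The torsion is taken in the
separable closure, which contains all the `lⁿ`-torsion whenever `γ(l) ≠ 0`. -/
def rationalTateRep (φ : DrinfeldModule Fq K) (l : Fq[X]) :
    Representation (FractionRing (AdicCompletion (Ideal.span {l}) Fq[X]))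
      Gal(SeparableClosure K/K) (RationalTateModule l (φ.Points (SeparableClosure K))) where
  toFun σ := (TateModule.map (φ.galoisMap σ)).baseChange _
  map_one' := by
    have : TateModule.map (l := l) (φ.galoisMap (1 : Gal(SeparableClosure K/K))) =
      LinearMap.id := rfl
    rw [this, LinearMap.baseChange_id]
    rfl
  map_mul' σ τ := by
    have : TateModule.map (l := l) (φ.galoisMap (σ * τ)) =
      (TateModule.map (φ.galoisMap σ)).comp (TateModule.map (φ.galoisMap τ)) := rfl
    rw [this, LinearMap.baseChange_comp]
    rfl

end DrinfeldModule

end Drinfeld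

/-! ### Local fields -/

section Local

/-- The inertia subgroup of the absolute Galois group of a nonarchimedean local field: the
automorphisms acting trivially on the ring of integers `O` of the separable closure modulo its
maximal ideal. As `K` is complete, `O` is local, so its maximal ideal is the Jacobson radical. -/
def inertiaGroup (K : Type*) [Field K] [ValuativeRel K] : Subgroup Gal(SeparableClosure K/K) :=
  ((⊥ : Ideal (integralClosure 𝒪[K] (SeparableClosure K))).jacobson).inertia
    Gal(SeparableClosure K/K)

variable {Fq : Type*} [Field Fq] [Finite Fq] {K : Type*} [Field K] [ValuativeRel K]
  [Algebra Fq[X] K] [Algebra Fq[X] 𝒪[K]]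

/-- `φ` has stable reduction: it is isomorphic over `K` to some `φ'` with coefficients in `𝒪[K]`
whose reduction modulo the maximal ideal is a Drinfeld module over the residue field. -/
def DrinfeldModule.HasStableReduction (φ : DrinfeldModule Fq K) : Prop :=
  ∃ (φ' : Fq[X] →+* TwistedPoly Fq 𝒪[K]) (φK : DrinfeldModule Fq K)
    (φbar : DrinfeldModule Fq 𝓀[K]),
    (∀ a n, (φK.toRingHom a).coeff n = algebraMap 𝒪[K] K ((φ' a).coeff n)) ∧
    φK.IsIsomorphic φ ∧
    (∀ a n, (φbar.toRingHom a).coeff n = IsLocalRing.residue 𝒪[K] ((φ' a).coeff n))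

end Local

end

/-!
Stable reduction is an isogeny invariant: scaling `u` so that it is integral with nonzero reduction,
Gauss's lemma in `K{τ}` makes a twist of `ψ` integral, and comparing degrees in the reduction of
`u φ = ψ u` shows that the reduction of `ψ` has the same rank as that of `φ`.

It remains to see that `φ` is stable. Write `φ_X = ∑ gᵢ τⁱ`, let `j ≥ 1` maximize
`v(gᵢ) ^ (1 / (qⁱ - 1))`, put `n = q ^ j - 1`, and choose `c` in the separable closure with
`c ^ n = gⱼ⁻¹`. Then `c⁻¹ φ c` is integral and its reduction has positive rank, so it has an
`l`-torsion point of the form `y⁻¹` with `y` a unit, and `c y⁻¹` is `l`-torsion for `φ`. A unipotent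
`σ` in inertia has a `p`-power acting trivially on `φ[l]`, so the same `p`-power of the tame
character `σ ↦ σ c / c` is trivial. This character has order dividing `n`, which is prime to `p`;
hence inertia fixes `c`, that is, `c` lies in an extension of `K` generated by roots of unity of
order prime to `p`. Some `K`-trace `d` of `c` times a root of unity is nonzero, and `d / c`, being
algebraic over the prime field, is a root of unity. So `v(d) ^ n = v(gⱼ)⁻¹` and `d⁻¹ φ d` is
stable over `K`.
-/

noncomputable section

namespace TwistedPoly

variable {Fq : Type*} [Field Fq] {S : Type*} [CommRing S] [Algebra Fq[X] S]

@[ext]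
theorem ext {f g : TwistedPoly Fq S} (h : ∀ n, f.coeff n = g.coeff n) : f = g :=
  SkewPolynomial.ext (R := S) h

/-- The twisted polynomial with prescribed coefficients. -/
def ofFinsupp (f : ℕ →₀ S) : TwistedPoly Fq S :=
  SkewMonoidAlgebra.ofCoeff (k := S) (G := Multiplicative ℕ) f

@[simp]
theorem coeff_ofFinsupp (f : ℕ →₀ S) (n : ℕ) : (ofFinsupp f : TwistedPoly Fq S).coeff n = f n :=
  rfl

/-- The coefficients of a twisted polynomial, as a finitely supported function. -/
def toFinsupp (f : TwistedPoly Fq S) : ℕ →₀ S :=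
  SkewMonoidAlgebra.coeff (k := S) (G := Multiplicative ℕ) f

@[simp]
theorem toFinsupp_apply (f : TwistedPoly Fq S) (n : ℕ) : f.toFinsupp n = f.coeff n := rfl

/-- `f` has degree `n` in `τ`. -/
def HasDegree (f : TwistedPoly Fq S) (n : ℕ) : Prop :=
  f.coeff n ≠ 0 ∧ ∀ m, n < m → f.coeff m = 0

theorem exists_hasDegree {f : TwistedPoly Fq S} {i : ℕ} (hi : f.coeff i ≠ 0) :
    ∃ n, i ≤ n ∧ f.HasDegree n := by
  have hi' : i ∈ f.toFinsupp.support := Finsupp.mem_support_iff.2 hi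
  refine ⟨f.toFinsupp.support.max' ⟨i, hi'⟩, Finset.le_max' _ _ hi',
    Finsupp.mem_support_iff.1 (f.toFinsupp.support.max'_mem ⟨i, hi'⟩), fun m hm => ?_⟩
  by_contra h
  exact hm.not_ge (Finset.le_max' _ _ (Finsupp.mem_support_iff.2 h))

theorem HasDegree.unique {f : TwistedPoly Fq S} {m n : ℕ} (hm : f.HasDegree m)
    (hn : f.HasDegree n) : m = n :=
  le_antisymm (le_of_not_gt fun h => hm.1 (hn.2 m h)) (le_of_not_gt fun h => hn.1 (hm.2 n h))

variable [Finite Fq]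

@[simp]
theorem coeff_zero (n : ℕ) : (0 : TwistedPoly Fq S).coeff n = 0 := rfl

@[simp]
theorem coeff_add (f g : TwistedPoly Fq S) (n : ℕ) : (f + g).coeff n = f.coeff n + g.coeff n :=
  SkewPolynomial.coeff_add (R := S) f g n

theorem coeff_mul (f g : TwistedPoly Fq S) (n : ℕ) :
    (f * g).coeff n = ∑ p ∈ Finset.HasAntidiagonal.antidiagonal n,
      f.coeff p.1 * g.coeff p.2 ^ (Nat.card Fq ^ p.1) := by
  let := frobeniusAction Fq S
  refine (SkewMonoidAlgebra.coeff_mul_antidiagonal_of_finset (k := S) (G := Multiplicative ℕ)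
    f g (Multiplicative.ofAdd n) ((Finset.HasAntidiagonal.antidiagonal n).map
      (Multiplicative.ofAdd.prodCongr Multiplicative.ofAdd).toEmbedding) ?_).trans
    (Finset.sum_map _ _ _)
  rintro ⟨a, b⟩
  exact Finset.mem_map_equiv.trans Finset.HasAntidiagonal.mem_antidiagonal

theorem exists_coeff_ne_zero {f : TwistedPoly Fq S} (hf : f ≠ 0) : ∃ n, f.coeff n ≠ 0 := by
  by_contra! h
  exact hf (ext h)

variable (Fq) in
/-- Constant twisted polynomials. -/
def C : S →+* TwistedPoly Fq S :=
  letI := frobeniusAction Fq S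
  SkewPolynomial.CRingHom

theorem coeff_C (c : S) (n : ℕ) : (C Fq c).coeff n = if n = 0 then c else 0 :=
  SkewPolynomial.coeff_C

@[simp]
theorem coeff_C_zero (c : S) : (C Fq c).coeff 0 = c := by simp [coeff_C]

theorem coeff_C_of_pos (c : S) {n : ℕ} (hn : 0 < n) : (C Fq c).coeff n = 0 := by
  simp [coeff_C, hn.ne']

theorem coeff_one (n : ℕ) : (1 : TwistedPoly Fq S).coeff n = if n = 0 then 1 else 0 := by
  rw [← map_one (C Fq), coeff_C]

@[simp]
theorem coeff_C_mul (c : S) (f : TwistedPoly Fq S) (n : ℕ) :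
    (C Fq c * f).coeff n = c * f.coeff n := by
  let := frobeniusAction Fq S
  exact SkewMonoidAlgebra.coeff_single_one_mul (k := S) (G := Multiplicative ℕ) f c _

@[simp]
theorem coeff_mul_C (f : TwistedPoly Fq S) (c : S) (n : ℕ) :
    (f * C Fq c).coeff n = f.coeff n * c ^ (Nat.card Fq ^ n) := by
  let := frobeniusAction Fq S
  exact SkewMonoidAlgebra.coeff_mul_single_one (k := S) (G := Multiplicative ℕ) f c _

theorem coeff_conj (f : TwistedPoly Fq S) (c : Sˣ) (n : ℕ) :
    (C Fq (↑c⁻¹ : S) * f * C Fq (c : S)).coeff n =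
      f.coeff n * (c : S) ^ (Nat.card Fq ^ n - 1) := by
  have hq : Nat.card Fq ^ n = (Nat.card Fq ^ n - 1) + 1 :=
    (Nat.succ_pred_eq_of_pos (pow_pos Nat.card_pos n)).symm
  rw [coeff_mul_C, coeff_C_mul, hq, pow_succ, Nat.add_sub_cancel]
  linear_combination f.coeff n * (c : S) ^ (Nat.card Fq ^ n - 1) * c.inv_mul

/-- The constant term, multiplicative because `τ` generates a two-sided ideal. -/
def constantCoeff : TwistedPoly Fq S →+* S where
  toFun f := f.coeff 0
  map_zero' := rfl
  map_one' := by simp [coeff_one]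
  map_add' f g := coeff_add f g 0
  map_mul' f g := by simp [coeff_mul]

@[simp]
theorem constantCoeff_apply (f : TwistedPoly Fq S) : constantCoeff f = f.coeff 0 := rfl

/-- `Fq` is central in `S{τ}` because its elements are fixed by the `q`-Frobenius. -/
instance : Algebra Fq (TwistedPoly Fq S) :=
  ((C Fq).comp ((algebraMap Fq[X] S).comp Polynomial.C)).toAlgebra' fun b f => by
    have := Fintype.ofFinite Fq
    ext n
    simp only [RingHom.comp_apply, coeff_C_mul, coeff_mul_C, ← map_pow, Nat.card_eq_fintype_card,
      FiniteField.pow_card_pow]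
    exact mul_comm _ _

theorem algebraMap_apply (b : Fq) :
    algebraMap Fq (TwistedPoly Fq S) b = C Fq (algebraMap Fq[X] S (Polynomial.C b)) := rfl

theorem coeff_zero_aeval {P : TwistedPoly Fq S} (hP : P.coeff 0 = algebraMap Fq[X] S X)
    (a : Fq[X]) : (aeval P a).coeff 0 = algebraMap Fq[X] S a := by
  have h : constantCoeff.comp (aeval P).toRingHom = algebraMap Fq[X] S := by
    refine Polynomial.ringHom_ext (fun b => ?_) ?_
    · simp [algebraMap_apply]
    · simpa using hP
  exact DFunLike.congr_fun h a

theorem mul_aeval_of_mul_eq_mul {u P Q : TwistedPoly Fq S} (h : u * P = Q * u) (a : Fq[X]) :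
    u * aeval P a = aeval Q a * u := by
  induction a using Polynomial.induction_on' with
  | add a b ha hb => rw [map_add, map_add, mul_add, add_mul, ha, hb]
  | monomial n b =>
    simp only [aeval_monomial]
    rw [← mul_assoc, ← Algebra.commutes, mul_assoc, mul_assoc,
      (SemiconjBy.pow_right (show SemiconjBy u P Q from h) n).eq]

section BaseChange

variable (S' : Type*) [CommRing S'] [Algebra Fq[X] S'] [Algebra S S'] [IsScalarTower Fq[X] S S']

/-- Extension of scalars `S{τ} → S'{τ}`. -/
def baseChange : TwistedPoly Fq S →ₐ[Fq] TwistedPoly Fq S' where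
  toFun f := ofFinsupp (f.toFinsupp.mapRange (algebraMap S S') (map_zero _))
  map_zero' := by ext n; simp
  map_add' f g := by ext n; simp
  map_one' := by
    ext n
    simp only [coeff_ofFinsupp, Finsupp.mapRange_apply, toFinsupp_apply, coeff_one,
      apply_ite (algebraMap S S'), map_one, map_zero]
  map_mul' f g := by ext n; simp [coeff_mul, map_sum]
  commutes' b := by
    ext n
    simp only [algebraMap_apply, coeff_ofFinsupp, Finsupp.mapRange_apply, toFinsupp_apply, coeff_C,
      apply_ite (algebraMap S S'), map_zero, ← IsScalarTower.algebraMap_apply]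

@[simp]
theorem coeff_baseChange (f : TwistedPoly Fq S) (n : ℕ) :
    (baseChange S' f).coeff n = algebraMap S S' (f.coeff n) := rfl

@[simp]
theorem baseChange_C (c : S) :
    baseChange S' (C Fq c) = C Fq (algebraMap S S' c) := by
  ext n
  simp only [coeff_baseChange, coeff_C, apply_ite (algebraMap S S'), map_zero]

variable {S'}

theorem baseChange_injective (h : Function.Injective (algebraMap S S')) :
    Function.Injective (baseChange S' : TwistedPoly Fq S →ₐ[Fq] TwistedPoly Fq S') :=
  fun f g hfg => ext fun n => h <| by rw [← coeff_baseChange, ← coeff_baseChange, hfg]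

theorem exists_baseChange_eq {f : TwistedPoly Fq S'}
    (h : ∀ n, f.coeff n ∈ (algebraMap S S').range) :
    ∃ f₀ : TwistedPoly Fq S, baseChange S' f₀ = f := by
  classical
  choose g hg using h
  refine ⟨ofFinsupp (Finsupp.onFinset f.toFinsupp.support
    (fun n => if f.coeff n = 0 then 0 else g n) fun n hn => ?_), ext fun n => ?_⟩
  · exact Finsupp.mem_support_iff.2 fun h0 => hn (if_pos h0)
  · rw [coeff_baseChange, coeff_ofFinsupp, Finsupp.onFinset_apply, apply_ite (algebraMap S S'),
      map_zero, hg]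
    exact ite_eq_right_iff.2 Eq.symm

end BaseChange

theorem HasDegree.ne_zero {f : TwistedPoly Fq S} {n : ℕ} (hf : f.HasDegree n) : f ≠ 0 := by
  rintro rfl
  exact hf.1 (coeff_zero n)

theorem HasDegree.mul [NoZeroDivisors S] {f g : TwistedPoly Fq S} {m n : ℕ} (hf : f.HasDegree m)
    (hg : g.HasDegree n) : (f * g).HasDegree (m + n) := by
  have hterm {i j : ℕ} (h : m < i ∨ n < j) : f.coeff i * g.coeff j ^ (Nat.card Fq ^ i) = 0 := by
    rcases h with h | h
    · rw [hf.2 i h, zero_mul]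
    · rw [hg.2 j h, zero_pow (pow_ne_zero _ Nat.card_pos.ne'), mul_zero]
  refine ⟨?_, fun r hr => ?_⟩
  · rw [coeff_mul, Finset.sum_eq_single (m, n)]
    · exact mul_ne_zero hf.1 (pow_ne_zero _ hg.1)
    · rintro ⟨i, j⟩ hij hne
      rw [Finset.HasAntidiagonal.mem_antidiagonal] at hij
      exact hterm (by grind)
    · exact fun h => absurd (Finset.HasAntidiagonal.mem_antidiagonal.2 (rfl : m + n = m + n)) h
  · rw [coeff_mul]
    refine Finset.sum_eq_zero fun p hp => hterm ?_
    rw [Finset.HasAntidiagonal.mem_antidiagonal] at hp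
    omega

instance [NoZeroDivisors S] : NoZeroDivisors (TwistedPoly Fq S) where
  eq_zero_or_eq_zero_of_mul_eq_zero {f g} h := by
    contrapose! h
    obtain ⟨i, hi⟩ := exists_coeff_ne_zero h.1
    obtain ⟨j, hj⟩ := exists_coeff_ne_zero h.2
    obtain ⟨m, -, hm⟩ := exists_hasDegree hi
    obtain ⟨n, -, hn⟩ := exists_hasDegree hj
    exact (hm.mul hn).ne_zero

theorem HasDegree.of_mul_eq_mul [NoZeroDivisors S] {f g u : TwistedPoly Fq S} {n : ℕ}
    (hf : f.HasDegree n) (hu : u ≠ 0) (h : u * f = g * u) : g.HasDegree n := by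
  have hg : g ≠ 0 := by
    rintro rfl
    exact mul_ne_zero hu hf.ne_zero (h.trans (zero_mul u))
  obtain ⟨i, hi⟩ := exists_coeff_ne_zero hu
  obtain ⟨j, hj⟩ := exists_coeff_ne_zero hg
  obtain ⟨m, -, hm⟩ := exists_hasDegree hi
  obtain ⟨s, -, hs⟩ := exists_hasDegree hj
  have hdeg : m + n = s + m := (hm.mul hf).unique (h ▸ hs.mul hm)
  rwa [show n = s by omega]

theorem HasDegree.add_C {f : TwistedPoly Fq S} {n : ℕ} (hf : f.HasDegree n) (hn : 0 < n) (c : S) :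
    (f + C Fq c).HasDegree n := by
  refine ⟨?_, fun m hm => ?_⟩
  · rw [coeff_add, coeff_C_of_pos c hn, add_zero]
    exact hf.1
  · rw [coeff_add, coeff_C_of_pos c (hn.trans hm), add_zero, hf.2 m hm]

theorem HasDegree.aeval [IsDomain S] {P : TwistedPoly Fq S} {r : ℕ} (hP : P.HasDegree r)
    (hr : 0 < r) {a : Fq[X]} (ha : a ≠ 0) :
    (Polynomial.aeval P a).HasDegree (r * a.natDegree) := by
  induction a using Polynomial.recOnHorner with
  | M0 => exact absurd rfl ha
  | MC p b hp hb ih =>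
    rw [natDegree_add_C, map_add, aeval_C, algebraMap_apply]
    rcases eq_or_ne p 0 with rfl | hp0
    · rw [map_zero, zero_add, natDegree_zero, mul_zero]
      refine ⟨?_, fun m hm => coeff_C_of_pos _ hm⟩
      rw [coeff_C_zero]
      exact (_root_.map_ne_zero ((algebraMap Fq[X] S).comp Polynomial.C)).2 hb
    · have hdeg : 0 < p.natDegree := natDegree_pos_iff_degree_pos.2 <|
        degree_pos_of_root hp0 (zero_isRoot_of_coeff_zero_eq_zero hp)
      exact (ih hp0).add_C (Nat.mul_pos hr hdeg) _
  | MX p hp ih =>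
    rw [natDegree_mul_X hp, map_mul, aeval_X, mul_add_one]
    exact (ih hp).mul hP

end TwistedPoly

namespace TwistedPoly

variable {Fq : Type*} [Field Fq] [Finite Fq] {K : Type*} [Field K] [Algebra Fq[X] K]
  {Γ₀ : Type*} [LinearOrderedCommGroupWithZero Γ₀] {v : Valuation K Γ₀}
  {R : Type*} [CommRing R] [IsLocalRing R] [Algebra Fq[X] R] [Algebra R K] [IsScalarTower Fq[X] R K]

theorem exists_eq_C_mul_baseChange (hv : v.Integers R) {f : TwistedPoly Fq K} (hf : f ≠ 0) :
    ∃ (c : Kˣ) (f₀ : TwistedPoly Fq R), f = C Fq (c : K) * baseChange K f₀ ∧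
      baseChange (IsLocalRing.ResidueField R) f₀ ≠ 0 := by
  obtain ⟨j, hj⟩ := exists_coeff_ne_zero hf
  obtain ⟨i, hi, hmax⟩ := Finset.exists_max_image f.toFinsupp.support
    (fun n => v (f.coeff n)) ⟨j, Finsupp.mem_support_iff.2 hj⟩
  have hi0 : f.coeff i ≠ 0 := Finsupp.mem_support_iff.1 hi
  let c : Kˣ := Units.mk0 _ hi0
  have hcc : C Fq (c : K) * C Fq (↑c⁻¹ : K) = 1 := by rw [← map_mul, Units.mul_inv, map_one]
  have hint (n : ℕ) : (C Fq (↑c⁻¹ : K) * f).coeff n ∈ (algebraMap R K).range := by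
    refine hv.exists_of_le_one ?_
    by_cases hn : f.coeff n = 0
    · simp [hn]
    · rw [coeff_C_mul, Units.val_inv_eq_inv_val, map_mul, map_inv₀]
      exact inv_mul_le_one_of_le₀ (hmax n (Finsupp.mem_support_iff.2 hn)) zero_le
  obtain ⟨f₀, hf₀⟩ := exists_baseChange_eq hint
  refine ⟨c, f₀, by rw [hf₀, ← mul_assoc, hcc, one_mul], fun h => ?_⟩
  have hone : f₀.coeff i = 1 := hv.hom_inj <| by
    rw [← coeff_baseChange, hf₀, coeff_C_mul, map_one]
    exact c.inv_mul
  simpa [hone] using congrArg (fun g => coeff g i) h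

/-- Gauss's lemma: it holds because twisted polynomials over the residue field have no zero
divisors. -/
theorem exists_baseChange_eq_of_mul_eq (hv : v.Integers R) {P : TwistedPoly Fq K}
    {U W : TwistedPoly Fq R} (hU : baseChange (IsLocalRing.ResidueField R) U ≠ 0)
    (h : P * baseChange K U = baseChange K W) : ∃ P₀ : TwistedPoly Fq R, baseChange K P₀ = P := by
  rcases eq_or_ne P 0 with rfl | hP
  · exact ⟨0, map_zero _⟩
  obtain ⟨e, Q, rfl, hQ⟩ := exists_eq_C_mul_baseChange hv hP
  rcases le_or_gt (v e) 1 with he | he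
  · obtain ⟨r, hr⟩ := hv.exists_of_le_one he
    exact ⟨C Fq r * Q, by rw [map_mul, baseChange_C, hr]⟩
  have he' : v (↑e⁻¹ : K) < 1 := by
    rw [Units.val_inv_eq_inv_val, map_inv₀]
    exact inv_lt_one_of_one_lt₀ he
  obtain ⟨r, hr⟩ := hv.exists_of_le_one he'.le
  have hr0 : algebraMap R (IsLocalRing.ResidueField R) r = 0 := by
    by_contra hne
    have hunit := (IsLocalRing.residue_ne_zero_iff_isUnit r).1 hne
    exact he'.ne (hr ▸ hv.isUnit_iff_valuation_eq_one.1 hunit)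
  have hee : C Fq (↑e⁻¹ : K) * C Fq (e : K) = 1 := by rw [← map_mul, Units.inv_mul, map_one]
  have hQU : Q * U = C Fq r * W := baseChange_injective hv.hom_inj <| by
    rw [map_mul, map_mul, baseChange_C, hr, ← h, mul_assoc (C Fq (e : K)), ← mul_assoc, hee,
      one_mul]
  have hred := congrArg (baseChange (IsLocalRing.ResidueField R)) hQU
  rw [map_mul, map_mul, baseChange_C, hr0, map_zero, zero_mul] at hred
  exact absurd hred (mul_ne_zero hQ hU)

end TwistedPoly

namespace DrinfeldModule

open TwistedPoly (baseChange)

variable {Fq : Type*} [Field Fq] [Finite Fq] {K : Type*} [Field K] [Algebra Fq[X] K]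

theorem hasDegree_X (φ : DrinfeldModule Fq K) : (φ.toRingHom X).HasDegree φ.rank :=
  ⟨φ.coeff_rank_ne_zero, fun m hm => φ.coeff_eq_zero _ _ (by simpa using hm)⟩

theorem toRingHom_apply (φ : DrinfeldModule Fq K) (a : Fq[X]) :
    φ.toRingHom a = aeval (φ.toRingHom X) a := by
  refine DFunLike.congr_fun (Polynomial.ringHom_ext (f := φ.toRingHom)
    (g := (aeval (φ.toRingHom X)).toRingHom) (fun b => ?_) (by simp)) a
  ext n
  rcases Nat.eq_zero_or_pos n with rfl | hn
  · simp [φ.coeff_zero, TwistedPoly.algebraMap_apply]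
  · simp [φ.coeff_eq_zero (C b) n (by simpa using hn), TwistedPoly.algebraMap_apply,
      TwistedPoly.coeff_C_of_pos _ hn]

theorem mul_toRingHom_eq {φ ψ : DrinfeldModule Fq K} {u : TwistedPoly Fq K}
    (h : u * φ.toRingHom X = ψ.toRingHom X * u) (a : Fq[X]) :
    u * φ.toRingHom a = ψ.toRingHom a * u := by
  rw [toRingHom_apply φ, toRingHom_apply ψ, TwistedPoly.mul_aeval_of_mul_eq_mul h]

/-- The Drinfeld module with `φ_X = P`. -/
def ofX (P : TwistedPoly Fq K) (hP₀ : P.coeff 0 = algebraMap Fq[X] K X) {r : ℕ} (hr : 1 ≤ r)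
    (hP : P.HasDegree r) : DrinfeldModule Fq K where
  toRingHom := (aeval P).toRingHom
  rank := r
  one_le_rank := hr
  coeff_zero := TwistedPoly.coeff_zero_aeval hP₀
  coeff_eq_zero a n hn := by
    rcases eq_or_ne a 0 with rfl | ha
    · rw [map_zero, TwistedPoly.coeff_zero]
    · exact (hP.aeval hr ha).2 n hn
  coeff_rank_ne_zero := by
    change (aeval P X).coeff r ≠ 0
    rw [aeval_X]
    exact hP.1

/-- The Drinfeld module `c⁻¹ φ c`, isomorphic to `φ` through `c`. -/
def twist (φ : DrinfeldModule Fq K) (c : Kˣ) : DrinfeldModule Fq K :=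
  ofX (TwistedPoly.C Fq (↑c⁻¹ : K) * φ.toRingHom X * TwistedPoly.C Fq (c : K))
    (by rw [TwistedPoly.coeff_conj, φ.coeff_zero, pow_zero, Nat.sub_self, pow_zero, mul_one])
    φ.one_le_rank
    ⟨by
      rw [TwistedPoly.coeff_conj]
      exact mul_ne_zero φ.coeff_rank_ne_zero (pow_ne_zero _ c.ne_zero),
    fun m hm => by rw [TwistedPoly.coeff_conj, φ.hasDegree_X.2 m hm, zero_mul]⟩

theorem twist_toRingHom_X (φ : DrinfeldModule Fq K) (c : Kˣ) :
    (φ.twist c).toRingHom X =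
      TwistedPoly.C Fq (↑c⁻¹ : K) * φ.toRingHom X * TwistedPoly.C Fq (c : K) :=
  aeval_X _

theorem C_mul_twist (φ : DrinfeldModule Fq K) (c : Kˣ) (a : Fq[X]) :
    TwistedPoly.C Fq (c : K) * (φ.twist c).toRingHom a =
      φ.toRingHom a * TwistedPoly.C Fq (c : K) := by
  refine mul_toRingHom_eq ?_ a
  rw [twist_toRingHom_X, ← mul_assoc, ← mul_assoc, ← map_mul, Units.mul_inv, map_one, one_mul]

theorem twist_isIsomorphic (φ : DrinfeldModule Fq K) (c : Kˣ) : (φ.twist c).IsIsomorphic φ :=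
  ⟨_, c.isUnit.map (TwistedPoly.C Fq), φ.C_mul_twist c⟩

theorem IsIsogeny.of_C_mul {φ ψ : DrinfeldModule Fq K} {c : Kˣ} {u : TwistedPoly Fq K}
    (h : φ.IsIsogeny ψ (TwistedPoly.C Fq (c : K) * u)) : φ.IsIsogeny (ψ.twist c) u := by
  refine ⟨right_ne_zero_of_mul h.1, fun a => ?_⟩
  apply (c.isUnit.map (TwistedPoly.C Fq)).mul_left_cancel
  rw [← mul_assoc, h.2, ← mul_assoc, ← mul_assoc, C_mul_twist]

section BaseChange

variable (L : Type*) [Field L] [Algebra Fq[X] L] [Algebra K L] [IsScalarTower Fq[X] K L]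

/-- Extension of scalars of a Drinfeld module along a field extension. -/
protected def baseChange (φ : DrinfeldModule Fq K) : DrinfeldModule Fq L :=
  ofX (baseChange L (φ.toRingHom X))
    (by rw [TwistedPoly.coeff_baseChange, φ.coeff_zero, ← IsScalarTower.algebraMap_apply])
    φ.one_le_rank
    ⟨by
      rw [TwistedPoly.coeff_baseChange]
      exact (_root_.map_ne_zero _).2 φ.coeff_rank_ne_zero,
    fun m hm => by rw [TwistedPoly.coeff_baseChange, φ.hasDegree_X.2 m hm, map_zero]⟩

theorem baseChange_toRingHom (φ : DrinfeldModule Fq K) (a : Fq[X]) :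
    (φ.baseChange L).toRingHom a = baseChange L (φ.toRingHom a) := by
  rw [φ.toRingHom_apply a, ← aeval_algHom_apply]
  rfl

end BaseChange

section StableModel

variable (R : Type*) [CommRing R] [IsLocalRing R] [Algebra Fq[X] R] [Algebra R K]
  [IsScalarTower Fq[X] R K]

/-- A model of a Drinfeld module over a local ring `R` with stable reduction: the reduction modulo
the maximal ideal is again a Drinfeld module, possibly of smaller rank. -/
structure StableModel (φ : DrinfeldModule Fq K) where
  /-- The Drinfeld module with coefficients in `R`. -/
  toRingHom : Fq[X] →+* TwistedPoly Fq R
  baseChange_toRingHom : ∀ a, baseChange K (toRingHom a) = φ.toRingHom a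
  /-- The reduction modulo the maximal ideal. -/
  reduction : DrinfeldModule Fq (IsLocalRing.ResidueField R)
  reduction_toRingHom : ∀ a,
    reduction.toRingHom a = baseChange (IsLocalRing.ResidueField R) (toRingHom a)

variable {R}

theorem nonempty_stableModel {φ : DrinfeldModule Fq K} (hinj : Function.Injective (algebraMap R K))
    {P : TwistedPoly Fq R} (hP : baseChange K P = φ.toRingHom X) {j : ℕ} (hj : 1 ≤ j)
    (hunit : IsUnit (P.coeff j)) : Nonempty (φ.StableModel R) := by
  have hP₀ : P.coeff 0 = algebraMap Fq[X] R X := hinj <| by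
    rw [← TwistedPoly.coeff_baseChange, hP, φ.coeff_zero, ← IsScalarTower.algebraMap_apply]
  obtain ⟨r, hjr, hr⟩ := TwistedPoly.exists_hasDegree
    (f := baseChange (IsLocalRing.ResidueField R) P)
    ((IsLocalRing.residue_ne_zero_iff_isUnit _).2 hunit)
  exact ⟨⟨(aeval P).toRingHom, fun a => by
      change baseChange K (aeval P a) = _
      rw [← aeval_algHom_apply, hP, ← φ.toRingHom_apply],
    ofX (baseChange (IsLocalRing.ResidueField R) P)
      (by rw [TwistedPoly.coeff_baseChange, hP₀, ← IsScalarTower.algebraMap_apply])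
      (hj.trans hjr) hr,
    fun a => aeval_algHom_apply _ _ _⟩⟩

theorem nonempty_stableModel_of_coeff_mem_range {φ : DrinfeldModule Fq K}
    (hinj : Function.Injective (algebraMap R K))
    (hint : ∀ i, (φ.toRingHom X).coeff i ∈ (algebraMap R K).range) {j : ℕ} (hj : 1 ≤ j) {y : R}
    (hy : IsUnit y) (hyj : algebraMap R K y = (φ.toRingHom X).coeff j) :
    Nonempty (φ.StableModel R) := by
  obtain ⟨P, hP⟩ := TwistedPoly.exists_baseChange_eq hint
  refine nonempty_stableModel hinj hP hj ?_
  rwa [← show y = P.coeff j from hinj (by rw [hyj, ← hP, TwistedPoly.coeff_baseChange])]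

variable {Γ₀ : Type*} [LinearOrderedCommGroupWithZero Γ₀] {v : Valuation K Γ₀}

theorem StableModel.of_isIsogeny_baseChange (hv : v.Integers R) {φ ψ : DrinfeldModule Fq K}
    (M : φ.StableModel R) {U : TwistedPoly Fq R} (h : φ.IsIsogeny ψ (baseChange K U))
    (hU : baseChange (IsLocalRing.ResidueField R) U ≠ 0) : Nonempty (ψ.StableModel R) := by
  have hcomm : ψ.toRingHom X * baseChange K U = baseChange K (U * M.toRingHom X) := by
    rw [map_mul, M.baseChange_toRingHom, h.2]
  obtain ⟨P, hP⟩ := TwistedPoly.exists_baseChange_eq_of_mul_eq hv hU hcomm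
  have hPU : U * M.toRingHom X = P * U :=
    TwistedPoly.baseChange_injective hv.hom_inj <| by rw [← hcomm, map_mul, hP]
  have hdeg := M.reduction.hasDegree_X.of_mul_eq_mul hU <| by
    rw [M.reduction_toRingHom, ← map_mul, hPU, map_mul]
  exact nonempty_stableModel hv.hom_inj hP M.reduction.one_le_rank
    ((IsLocalRing.residue_ne_zero_iff_isUnit _).1 hdeg.1)

theorem StableModel.exists_twist_of_isIsogeny (hv : v.Integers R) {φ ψ : DrinfeldModule Fq K}
    (M : φ.StableModel R) {u : TwistedPoly Fq K} (hu : φ.IsIsogeny ψ u) :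
    ∃ c : Kˣ, Nonempty ((ψ.twist c).StableModel R) := by
  obtain ⟨c, U, rfl, hU⟩ := TwistedPoly.exists_eq_C_mul_baseChange hv hu.1
  exact ⟨c, M.of_isIsogeny_baseChange hv hu.of_C_mul hU⟩

end StableModel

section StableReduction

variable [ValuativeRel K] [Algebra Fq[X] 𝒪[K]] [IsScalarTower Fq[X] 𝒪[K] K]

theorem hasStableReduction_iff {φ : DrinfeldModule Fq K} :
    φ.HasStableReduction ↔
      ∃ φK : DrinfeldModule Fq K, φK.IsIsomorphic φ ∧ Nonempty (φK.StableModel 𝒪[K]) := by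
  constructor
  · rintro ⟨φ', φK, φbar, h, hiso, hbar⟩
    exact ⟨φK, hiso, ⟨φ', fun a => TwistedPoly.ext fun n => (h a n).symm, φbar,
      fun a => TwistedPoly.ext fun n => hbar a n⟩⟩
  · rintro ⟨φK, hiso, ⟨M⟩⟩
    exact ⟨M.toRingHom, φK, M.reduction,
      fun a n => by rw [← M.baseChange_toRingHom, TwistedPoly.coeff_baseChange], hiso,
      fun a n => by rw [M.reduction_toRingHom]; rfl⟩

theorem hasStableReduction_of_twist {φ : DrinfeldModule Fq K} {c : Kˣ}
    (h : Nonempty ((φ.twist c).StableModel 𝒪[K])) : φ.HasStableReduction :=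
  hasStableReduction_iff.2 ⟨_, φ.twist_isIsomorphic c, h⟩

theorem HasStableReduction.of_isIsogeny {φ ψ : DrinfeldModule Fq K} {u : TwistedPoly Fq K}
    (h : φ.HasStableReduction) (hu : φ.IsIsogeny ψ u) : ψ.HasStableReduction := by
  obtain ⟨φK, ⟨w, hw, hwφ⟩, ⟨M⟩⟩ := hasStableReduction_iff.1 h
  have huw : φK.IsIsogeny ψ (u * w) := by
    refine ⟨hw.mul_left_eq_zero.not.2 hu.1, fun a => ?_⟩
    rw [mul_assoc, hwφ, ← mul_assoc, hu.2, mul_assoc]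
  obtain ⟨c, hc⟩ := M.exists_twist_of_isIsogeny (Valuation.integer.integers (valuation K)) huw
  exact hasStableReduction_of_twist hc

end StableReduction

end DrinfeldModule

section CompleteLocal

universe v

theorem isAdicComplete_of_finite {R : Type v} [CommRing R] [IsNoetherianRing R] (I : Ideal R)
    [IsAdicComplete I R] (M : Type v) [AddCommGroup M] [Module R M] [Module.Finite R M] :
    IsAdicComplete I M := by
  rw [← AdicCompletion.of_bijective_iff]
  let e := (TensorProduct.lid R M).symm.trans
    (LinearEquiv.rTensor M (AdicCompletion.ofLinearEquiv I R))
  have hof : ⇑(AdicCompletion.of I M) = AdicCompletion.ofTensorProduct I M ∘ e := by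
    ext1 x
    change _ = AdicCompletion.ofTensorProduct I M (1 ⊗ₜ[R] x)
    rw [AdicCompletion.ofTensorProduct_tmul, one_smul]
  rw [hof]
  exact (AdicCompletion.ofTensorProduct_bijective_of_finite_of_isNoetherian I M).comp e.bijective

theorem exists_isIdempotentElem_pow {M : Type*} [Monoid M] [Finite M] (x : M) :
    ∃ n, n ≠ 0 ∧ IsIdempotentElem (x ^ n) := by
  let : TopologicalSpace M := ⊥
  have : DiscreteTopology M := ⟨rfl⟩
  obtain ⟨_, ⟨n, rfl⟩, hn⟩ := exists_idempotent_in_compact_subsemigroup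
    (fun _ : M => continuous_of_discreteTopology) (Set.range fun n : ℕ => x ^ (n + 1))
    (Set.range_nonempty _) (Set.toFinite _).isCompact <| by
      rintro _ ⟨i, rfl⟩ _ ⟨j, rfl⟩
      exact ⟨i + 1 + j, pow_add x (i + 1) (j + 1)⟩
  exact ⟨n + 1, n.succ_ne_zero, hn⟩

theorem exists_isIdempotentElem_sub_mem {R : Type*} [CommRing R] {J : Ideal R} [HenselianRing R J]
    {e : R} (he : IsIdempotentElem (Ideal.Quotient.mk J e)) :
    ∃ a : R, IsIdempotentElem a ∧ a - e ∈ J := by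
  obtain ⟨a, ha, hae⟩ := HenselianRing.is_henselian (I := J) (X ^ 2 - X : R[X])
    (by monicity!) e
    (by
      rw [← Ideal.Quotient.eq_zero_iff_mem]
      simpa [sub_eq_zero, pow_two, IsIdempotentElem] using he)
    (by
      have hderiv : Ideal.Quotient.mk J (eval e (derivative (X ^ 2 - X : R[X]))) =
          2 * Ideal.Quotient.mk J e - 1 := by
        simp [one_add_one_eq_two, map_ofNat]
      rw [hderiv]
      exact IsUnit.of_mul_eq_one (2 * Ideal.Quotient.mk J e - 1)
        (by linear_combination 4 * he.eq))
  refine ⟨a, ?_, hae⟩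
  simpa [IsIdempotentElem, sub_eq_zero, pow_two] using ha

theorem isLocalRing_of_henselianRing {R : Type*} [CommRing R] [IsDomain R] (J : Ideal R)
    [HenselianRing R J] [Finite (R ⧸ J)] : IsLocalRing R := by
  have hunit (z : R) (hz : z ∈ J) : IsUnit (1 - z) := by
    have := Ideal.mem_jacobson_bot.1 (HenselianRing.jac hz) (-1)
    rwa [mul_neg_one, neg_add_eq_sub] at this
  refine IsLocalRing.of_isUnit_or_isUnit_one_sub_self fun x => ?_
  obtain ⟨n, hn, hidem⟩ := exists_isIdempotentElem_pow (Ideal.Quotient.mk J x)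
  rw [← map_pow] at hidem
  obtain ⟨a, ha, hax⟩ := exists_isIdempotentElem_sub_mem hidem
  rcases IsIdempotentElem.iff_eq_zero_or_one.1 ha with rfl | rfl
  · right
    rw [zero_sub, neg_mem_iff] at hax
    exact isUnit_of_dvd_unit (one_sub_dvd_one_sub_pow x n) (hunit _ hax)
  · left
    have := hunit _ hax
    rwa [sub_sub_cancel, isUnit_pow_iff hn] at this

theorem isLocalRing_of_isIntegral_of_isAdicComplete {R B : Type v} [CommRing R]
    [IsNoetherianRing R] (I : Ideal R) [IsAdicComplete I R] [Finite (R ⧸ I)] [CommRing B]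
    [IsDomain B] [Algebra R B] [Algebra.IsIntegral R B] : IsLocalRing B := by
  refine IsLocalRing.of_isUnit_or_isUnit_one_sub_self fun x => ?_
  let S := Algebra.adjoin R {x}
  have : Module.Finite R S :=
    Module.Finite.iff_fg.2 (Algebra.IsIntegral.isIntegral (R := R) x).fg_adjoin_singleton
  let J := I.map (algebraMap R S)
  have : IsAdicComplete J S :=
    (IsAdicComplete.map_algebraMap_iff I S).2 (isAdicComplete_of_finite I S)
  have : Finite (S ⧸ J) := by
    have : Module.Finite (R ⧸ I) (S ⧸ J) := Module.Finite.of_restrictScalars_finite R (R ⧸ I) _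
    exact Module.finite_of_finite (R ⧸ I)
  have := isLocalRing_of_henselianRing J
  let y : S := ⟨x, Algebra.self_mem_adjoin_singleton R x⟩
  exact (IsLocalRing.isUnit_or_isUnit_one_sub_self y).imp (·.map S.val) (·.map S.val)

end CompleteLocal

section LocalField

variable (K : Type*) [Field K] [ValuativeRel K] [TopologicalSpace K] [IsNonarchimedeanLocalField K]

instance isLocalRing_integralClosure_separableClosure :
    IsLocalRing (integralClosure 𝒪[K] (SeparableClosure K)) := by
  let := IsTopologicalAddGroup.rightUniformSpace K
  have := isUniformAddGroup_of_addCommGroup (G := K)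
  have : Finite (𝒪[K] ⧸ 𝓂[K]) := inferInstanceAs (Finite 𝓀[K])
  exact isLocalRing_of_isIntegral_of_isAdicComplete 𝓂[K]

variable {K}

theorem mem_inertiaGroup_iff {σ : Gal(SeparableClosure K/K)} :
    σ ∈ inertiaGroup K ↔ ∀ x : integralClosure 𝒪[K] (SeparableClosure K),
      σ • x - x ∈ IsLocalRing.maximalIdeal (integralClosure 𝒪[K] (SeparableClosure K)) := by
  rw [inertiaGroup, IsLocalRing.jacobson_eq_maximalIdeal ⊥ bot_ne_top]
  rfl

end LocalField

theorem splits_of_splits_map_of_isIntegrallyClosedIn {B L : Type*} [CommRing B] [Field L]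
    [Algebra B L] [IsIntegrallyClosedIn B L] {P : B[X]} (hP : P.Monic)
    (hs : (P.map (algebraMap B L)).Splits) : P.Splits :=
  hs.of_splits_map_of_injective (IsIntegralClosure.algebraMap_injective B B L) fun x hx =>
    IsIntegrallyClosedIn.isIntegral_iff.1
      ⟨P, hP, by rw [← eval_map]; exact isRoot_of_mem_roots hx⟩

theorem exists_pow_eq_one_of_isIntegral {k F : Type*} [Field k] [Finite k] [Field F] [Algebra k F]
    {x : F} (hx : IsIntegral k x) (hx0 : x ≠ 0) : ∃ m : ℕ, (m : F) ≠ 0 ∧ x ^ m = 1 := by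
  have := IntermediateField.adjoin.finiteDimensional hx
  have : Finite (IntermediateField.adjoin k {x}) := Module.finite_of_finite k
  let := Fintype.ofFinite (IntermediateField.adjoin k {x})
  refine ⟨Fintype.card (IntermediateField.adjoin k {x}) - 1, ?_, ?_⟩
  · have hcard := congrArg (algebraMap (IntermediateField.adjoin k {x}) F)
      (FiniteField.cast_card_eq_zero (IntermediateField.adjoin k {x}))
    rw [map_natCast, map_zero] at hcard
    rw [Nat.cast_sub Fintype.card_pos, Nat.cast_one, hcard, zero_sub]
    exact neg_ne_zero.2 one_ne_zero
  · exact congrArg Subtype.val (FiniteField.pow_card_sub_one_eq_one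
      (⟨x, IntermediateField.mem_adjoin_simple_self k x⟩ : IntermediateField.adjoin k {x})
      (fun h => hx0 (congrArg Subtype.val h)))

theorem exists_pow_sub_one_mem_maximalIdeal (R : Type*) {B : Type*} [CommRing R] [IsLocalRing R]
    [Finite (IsLocalRing.ResidueField R)] [CommRing B] [IsLocalRing B] [Algebra R B]
    [IsLocalHom (algebraMap R B)] [Algebra.IsIntegral R B] {x : B} (hx : IsUnit x) :
    ∃ m : ℕ, (m : IsLocalRing.ResidueField B) ≠ 0 ∧ x ^ m - 1 ∈ IsLocalRing.maximalIdeal B := by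
  have hint : IsIntegral (IsLocalRing.ResidueField R) (IsLocalRing.residue B x) :=
    ((Algebra.IsIntegral.isIntegral (R := R) x).map
      (IsScalarTower.toAlgHom R B (IsLocalRing.ResidueField B))).tower_top
  obtain ⟨m, hm, hxm⟩ := exists_pow_eq_one_of_isIntegral hint
    ((IsLocalRing.residue_ne_zero_iff_isUnit x).2 hx)
  refine ⟨m, hm, ?_⟩
  rwa [← IsLocalRing.residue_eq_zero_iff, map_sub, map_pow, map_one, sub_eq_zero]

theorem exists_rootOfUnity_sub_mem_maximalIdeal (R : Type*) {B : Type*} (L : Type*) [CommRing R]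
    [IsLocalRing R] [Finite (IsLocalRing.ResidueField R)] [CommRing B] [IsDomain B] [IsLocalRing B]
    [Algebra R B] [IsLocalHom (algebraMap R B)] [Algebra.IsIntegral R B] [Field L] [IsSepClosed L]
    [Algebra B L] [IsIntegrallyClosedIn B L] {x : B} (hx : IsUnit x) :
    ∃ (m : ℕ) (ζ : B), (m : L) ≠ 0 ∧ ζ ^ m = 1 ∧ x - ζ ∈ IsLocalRing.maximalIdeal B := by
  obtain ⟨m, hm, hxm⟩ := exists_pow_sub_one_mem_maximalIdeal R hx
  have hmL : (m : L) ≠ 0 := fun h => hm <| by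
    rw [← map_natCast (algebraMap B L),
      map_eq_zero_iff _ (IsIntegralClosure.algebraMap_injective B B L)] at h
    rw [← map_natCast (IsLocalRing.residue B), h, map_zero]
  have hP : (X ^ m - C 1 : B[X]).Monic := monic_X_pow_sub_C _ fun h => hm (by simp [h])
  have hs : (X ^ m - C 1 : B[X]).Splits :=
    splits_of_splits_map_of_isIntegrallyClosedIn (L := L) hP <| by
      simpa using IsSepClosed.splits_of_separable _ (separable_X_pow_sub_C 1 hmL one_ne_zero)
  have heval := hs.eval_eq_prod_roots_of_monic hP x
  rw [eval_sub, eval_pow, eval_X, eval_C] at heval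
  rw [heval] at hxm
  obtain ⟨_, hmem, hxζ⟩ := ((IsLocalRing.maximalIdeal.isMaximal
    B).isPrime.multiset_prod_mem_iff_exists_mem _).1 hxm
  obtain ⟨ζ, hζ, rfl⟩ := Multiset.mem_map.1 hmem
  refine ⟨m, ζ, hmL, ?_, hxζ⟩
  simpa [sub_eq_zero] using isRoot_of_mem_roots hζ

theorem exists_trace_mul_rootOfUnity_ne_zero {K E : Type*} [Field K] [Field E] [Algebra K E]
    (m : ℕ) [NeZero m] [IsCyclotomicExtension {m} K E] {c : E} (hc : c ≠ 0) :
    ∃ ζ : E, ζ ^ m = 1 ∧ Algebra.trace K E (c * ζ) ≠ 0 := by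
  have := IsCyclotomicExtension.isGalois {m} K E
  have := IsCyclotomicExtension.finiteDimensional {m} K E
  let restrict (σ : Gal(E/K)) : rootsOfUnity m E →* E :=
    ((σ : E →+* E) : E →* E).comp ((Units.coeHom E).comp (rootsOfUnity m E).subtype)
  have hinj : Function.Injective restrict := fun σ τ h =>
    IsCyclotomicExtension.algEquiv_eq_of_apply_eq {m} K E fun n hn hn0 => by
      obtain ⟨ζ, hζ⟩ := IsCyclotomicExtension.exists_isPrimitiveRoot K E hn hn0
      obtain rfl := Set.mem_singleton_iff.1 hn
      exact ⟨ζ, hζ, DFunLike.congr_fun h (rootsOfUnity.mkOfPowEq ζ hζ.pow_eq_one)⟩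
  have hli := (linearIndependent_monoidHom (rootsOfUnity m E) E).comp restrict hinj
  by_contra! htr
  refine hc (Fintype.linearIndependent_iff.1 hli (fun σ => σ c) (funext fun ζ => ?_) 1)
  have hζ : ((ζ : Eˣ) : E) ^ m = 1 := (mem_rootsOfUnity' m _).1 ζ.2
  have hsum := congrArg (algebraMap K E) (htr _ hζ)
  simp only [trace_eq_sum_automorphisms, map_mul, map_zero] at hsum
  rw [Finset.sum_apply]
  exact hsum

theorem exists_algebraMap_eq_mul_rootOfUnity_of_isCyclotomicExtension {K E : Type*} [Field K]
    [Field E] [Algebra K E] (p : ℕ) [Fact p.Prime] [CharP E p] {m n : ℕ} [NeZero m]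
    [IsCyclotomicExtension {m} K E] (hnm : n ∣ m) {c : E} (hc0 : c ≠ 0)
    (hc : c ^ n ∈ (algebraMap K E).range) :
    ∃ (d : K) (z : E) (s : ℕ), s ≠ 0 ∧ z ^ s = 1 ∧ algebraMap K E d = c * z := by
  have := IsCyclotomicExtension.isGalois {m} K E
  have := IsCyclotomicExtension.finiteDimensional {m} K E
  let := ZMod.algebra E p
  obtain ⟨ζ, hζ, htr⟩ := exists_trace_mul_rootOfUnity_ne_zero (K := K) m hc0
  let z := algebraMap K E (Algebra.trace K E (c * ζ)) / c
  have hpow (σ : Gal(E/K)) : (σ (c * ζ) / c) ^ m = 1 := by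
    obtain ⟨g, hg⟩ := hc
    obtain ⟨e, rfl⟩ := hnm
    have hσc : σ c ^ (n * e) = c ^ (n * e) := by
      rw [pow_mul, pow_mul, ← map_pow, ← hg, AlgEquiv.commutes]
    rw [div_pow, map_mul, mul_pow, hσc, ← map_pow, hζ, map_one, mul_one,
      div_self (pow_ne_zero _ hc0)]
  have hz : IsIntegral (ZMod p) z := by
    simp only [z, trace_eq_sum_automorphisms, Finset.sum_div]
    refine IsIntegral.sum _ fun σ _ => IsIntegral.of_pow (NeZero.pos m) ?_
    rw [hpow]
    exact isIntegral_one
  have hz0 : z ≠ 0 := div_ne_zero (by simpa using htr) hc0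
  obtain ⟨s, hs, hzs⟩ := exists_pow_eq_one_of_isIntegral hz hz0
  refine ⟨_, z, s, ?_, hzs, (mul_div_cancel₀ _ hc0).symm⟩
  rintro rfl
  exact hs Nat.cast_zero

theorem exists_mem_adjoin_pow_eq_one {K L : Type*} [Field K] [Field L] [Algebra K L] {c : L}
    (hc : c ∈ IntermediateField.adjoin K {ζ : L | ∃ m : ℕ, (m : L) ≠ 0 ∧ ζ ^ m = 1}) :
    ∃ m : ℕ, (m : L) ≠ 0 ∧ c ∈ IntermediateField.adjoin K {ζ : L | ζ ^ m = 1} := by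
  obtain ⟨T, hT, hcT⟩ := IntermediateField.exists_finset_of_mem_adjoin hc
  choose! m hm using fun ζ (hζ : ζ ∈ T) => hT hζ
  refine ⟨∏ ζ ∈ T, m ζ, ?_, IntermediateField.adjoin.mono K _ _ (fun ζ hζ => ?_) hcT⟩
  · rw [Nat.cast_prod]
    exact Finset.prod_ne_zero_iff.2 fun ζ hζ => (hm ζ hζ).1
  · obtain ⟨e, he⟩ := Finset.dvd_prod_of_mem m hζ
    change ζ ^ _ = 1
    rw [he, pow_mul, (hm ζ hζ).2, one_pow]

theorem isCyclotomicExtension_adjoin_pow_eq_one (K L : Type*) [Field K] [Field L] [Algebra K L]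
    [IsSepClosed L] (m : ℕ) [NeZero (m : L)] :
    IsCyclotomicExtension {m} K (IntermediateField.adjoin K {ζ : L | ζ ^ m = 1}) := by
  have hm : m ≠ 0 := fun h => NeZero.ne (m : L) (by simp [h])
  have := IntermediateField.isCyclotomicExtension_adjoin_of_exists_isPrimitiveRoot {m} K L <| by
    rintro _ rfl -
    exact HasEnoughRootsOfUnity.exists_primitiveRoot L _
  have hset : {ζ : L | ∃ n ∈ ({m} : Set ℕ), n ≠ 0 ∧ ζ ^ n = 1} = {ζ | ζ ^ m = 1} := by
    ext ζ
    simp [hm]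
  rwa [hset] at this

theorem exists_algebraMap_eq_mul_rootOfUnity {K L : Type*} [Field K] [Field L] [Algebra K L]
    [IsSepClosed L] (p : ℕ) [Fact p.Prime] [CharP L p] {n : ℕ} (hn : (n : L) ≠ 0) {c : L}
    (hc0 : c ≠ 0) (hcn : c ^ n ∈ (algebraMap K L).range)
    (hc : c ∈ IntermediateField.adjoin K {ζ : L | ∃ m : ℕ, (m : L) ≠ 0 ∧ ζ ^ m = 1}) :
    ∃ (d : K) (z : L) (s : ℕ), s ≠ 0 ∧ z ^ s = 1 ∧ algebraMap K L d = c * z := by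
  obtain ⟨m₀, hm₀, hcm₀⟩ := exists_mem_adjoin_pow_eq_one hc
  let m := n * m₀
  have : NeZero (m : L) := ⟨by simpa only [m, Nat.cast_mul] using mul_ne_zero hn hm₀⟩
  have : NeZero m := .of_neZero_natCast L
  let E := IntermediateField.adjoin K {ζ : L | ζ ^ m = 1}
  have := isCyclotomicExtension_adjoin_pow_eq_one K L m
  have : CharP E p := (algebraMap E L).charP (algebraMap E L).injective p
  have hcE : c ∈ E := by
    refine IntermediateField.adjoin.mono K _ _ (fun ζ (hζ : ζ ^ m₀ = 1) => ?_) hcm₀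
    change ζ ^ (n * m₀) = 1
    rw [mul_comm, pow_mul, hζ, one_pow]
  obtain ⟨g, hg⟩ := hcn
  obtain ⟨d, z, s, hs, hz, hd⟩ := exists_algebraMap_eq_mul_rootOfUnity_of_isCyclotomicExtension
    (K := K) (m := m) (c := (⟨c, hcE⟩ : E)) p (Dvd.intro m₀ rfl)
    (fun h => hc0 (congrArg Subtype.val h)) ⟨g, Subtype.ext hg⟩
  exact ⟨d, z, s, hs, congrArg Subtype.val hz, congrArg Subtype.val hd⟩

section LocalField

variable {K : Type*} [Field K] [ValuativeRel K] [TopologicalSpace K] [IsNonarchimedeanLocalField K]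

theorem mem_inertiaGroup_of_fixes_rootsOfUnity {σ : Gal(SeparableClosure K/K)}
    (h : ∀ (m : ℕ) (ζ : SeparableClosure K), (m : SeparableClosure K) ≠ 0 → ζ ^ m = 1 → σ ζ = ζ) :
    σ ∈ inertiaGroup K := by
  let B := integralClosure 𝒪[K] (SeparableClosure K)
  have : IsLocalHom (algebraMap 𝒪[K] B) :=
    RingHom.IsIntegral.isLocalHom Algebra.IsIntegral.isIntegral fun a b h =>
      Subtype.ext ((algebraMap K (SeparableClosure K)).injective (congrArg Subtype.val h))
  have hsmul {y : B} (hy : y ∈ IsLocalRing.maximalIdeal B) : σ • y ∈ IsLocalRing.maximalIdeal B :=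
    fun hu => hy ((MulEquiv.isUnit_map (MulSemiringAction.toRingEquiv _ B σ)).1 hu)
  rw [mem_inertiaGroup_iff]
  intro x
  by_cases hx : IsUnit x
  · obtain ⟨m, ζ, hm, hζ, hxζ⟩ :=
      exists_rootOfUnity_sub_mem_maximalIdeal 𝒪[K] (SeparableClosure K) hx
    have hσζ : σ • ζ = ζ := Subtype.ext (h m ζ hm (by exact_mod_cast congrArg Subtype.val hζ))
    have hdiff := sub_mem (hsmul hxζ) hxζ
    rwa [smul_sub, hσζ, sub_sub_sub_cancel_right] at hdiff
  · exact sub_mem (hsmul hx) hx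

theorem mem_adjoin_rootsOfUnity_of_inertiaGroup_fixes {c : SeparableClosure K}
    (hc : ∀ σ ∈ inertiaGroup K, σ c = c) :
    c ∈ IntermediateField.adjoin K
      {ζ : SeparableClosure K | ∃ m : ℕ, (m : SeparableClosure K) ≠ 0 ∧ ζ ^ m = 1} := by
  rw [← InfiniteGalois.fixedField_fixingSubgroup (IntermediateField.adjoin K _),
    IntermediateField.mem_fixedField_iff]
  intro σ hσ
  rw [IntermediateField.mem_fixingSubgroup_iff] at hσ
  exact hc σ (mem_inertiaGroup_of_fixes_rootsOfUnity fun m ζ hm hζ =>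
    hσ ζ (IntermediateField.subset_adjoin _ _ ⟨m, hm, hζ⟩))

theorem exists_valuation_pow_eq_of_inertiaGroup_fixes (p : ℕ) [Fact p.Prime] [CharP K p]
    {c : SeparableClosure K} {n : ℕ} (hn : (n : SeparableClosure K) ≠ 0) {g : K} (hg : g ≠ 0)
    (hcg : c ^ n = algebraMap K (SeparableClosure K) g)
    (hc : ∀ σ ∈ inertiaGroup K, σ c = c) :
    ∃ d : K, valuation K d ^ n = valuation K g := by
  have : CharP (SeparableClosure K) p :=
    charP_of_injective_algebraMap (algebraMap K (SeparableClosure K)).injective p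
  have hn0 : n ≠ 0 := fun h => hn (by simp [h])
  have hc0 : c ≠ 0 := by
    rw [← pow_ne_zero_iff hn0, hcg]
    simpa using hg
  obtain ⟨d, z, s, hs, hz, hd⟩ := exists_algebraMap_eq_mul_rootOfUnity p hn hc0 ⟨g, hcg.symm⟩
    (mem_adjoin_rootsOfUnity_of_inertiaGroup_fixes hc)
  have hdg : (d ^ n) ^ s = g ^ s := by
    refine (algebraMap K (SeparableClosure K)).injective ?_
    rw [map_pow, map_pow, map_pow, hd, mul_pow, hcg, mul_pow, pow_right_comm, hz, one_pow, mul_one]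
  refine ⟨d, (pow_left_inj₀ zero_le zero_le hs).1 ?_⟩
  simp only [← map_pow, hdg]

end LocalField

theorem pow_smul_eq_zero_of_not_pow_dvd {A M : Type*} [CommRing A] [IsDomain A]
    [IsPrincipalIdealRing A] [AddCommGroup M] [Module A M] {l b : A} (hl : Prime l) {x : M}
    {N n : ℕ} (hN : l ^ N • x = 0) (hb : b • x = 0) (hn : ¬ l ^ n ∣ b) : l ^ n • x = 0 := by
  let d := Submodule.IsPrincipal.generator (Ideal.torsionOf A M x)
  have hd (a : A) : a • x = 0 ↔ d ∣ a := by
    rw [← Ideal.mem_torsionOf_iff]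
    exact Submodule.IsPrincipal.mem_iff_generator_dvd _
  obtain ⟨k, -, hk⟩ := (dvd_prime_pow hl N).1 ((hd _).1 hN)
  have hkn : k ≤ n := by
    by_contra! hlt
    exact hn ((pow_dvd_pow l hlt.le).trans (hk.dvd_iff_dvd_left.1 ((hd b).1 hb)))
  exact (hd _).2 (hk.dvd.trans (pow_dvd_pow l hkn))

namespace TateModule

variable {A : Type*} [CommRing A] {l : A} {M : Type*} [AddCommGroup M] [Module A M]

theorem pow_smul_apply_add (x : TateModule l M) (n m : ℕ) : l ^ n • x.1 (m + n) = x.1 m := by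
  induction n with
  | zero => rw [pow_zero, one_smul, add_zero]
  | succ n ih => rw [pow_succ, mul_smul, ← add_assoc, x.2.2, ih]

theorem exists_apply_one_eq (hsurj : ∀ x : M, ∃ y : M, l • y = x) {x : M} (hx : l • x = 0) :
    ∃ t : TateModule l M, t.1 1 = x := by
  choose f hf using hsurj
  refine ⟨⟨fun | 0 => 0 | n + 1 => f^[n] x, rfl, fun n => ?_⟩, rfl⟩
  cases n with
  | zero => exact hx
  | succ n => exact (congrArg (l • ·) (Function.iterate_succ_apply' f n x)).trans (hf _)

theorem exists_forall_not_pow_dvd {b : AdicCompletion.AdicCauchySequence (Ideal.span {l}) A}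
    (hb : AdicCompletion.mk (Ideal.span {l}) A b ≠ 0) : ∃ n, ∀ m, ¬ l ^ n ∣ b (m + n) := by
  contrapose! hb
  refine AdicCompletion.ext_evalₐ fun n => ?_
  obtain ⟨m, hm⟩ := hb n
  have hmem := AdicCompletion.Ideal.mk_eq_mk (Ideal.span {l}) (Nat.le_add_left n m) b
  rw [AdicCompletion.evalₐ_mk, map_zero, ← hmem, Ideal.Quotient.eq_zero_iff_mem,
    Ideal.span_singleton_pow, Ideal.mem_span_singleton]
  exact hm

theorem eq_zero_of_smul_eq_zero [IsDomain A] [IsPrincipalIdealRing A] (hl : Prime l)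
    {s : AdicCompletion (Ideal.span {l}) A} (hs : s ≠ 0) {t : TateModule l M} (h : s • t = 0) :
    t = 0 := by
  obtain ⟨b, rfl⟩ := AdicCompletion.mk_surjective _ _ s
  obtain ⟨n, hn⟩ := exists_forall_not_pow_dvd hs
  refine Subtype.ext (funext fun m => ?_)
  have hb : b (m + n) • t.1 (m + n) = 0 := by
    rw [← completion_smul_apply _ t (m + n) (AdicCompletion.evalₐ_mk _ _ b), h]
    rfl
  rw [← pow_smul_apply_add t n m]
  exact pow_smul_eq_zero_of_not_pow_dvd hl (pow_smul_apply t (m + n)) hb (hn m)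

theorem one_tmul_injective [IsDomain A] [IsPrincipalIdealRing A] (hl : Prime l) :
    Function.Injective fun t : TateModule l M =>
      ((1 : FractionRing (AdicCompletion (Ideal.span {l}) A)) ⊗ₜ t : RationalTateModule l M) := by
  have : Nontrivial (AdicCompletion (Ideal.span {l}) A) := by
    have : Nontrivial (A ⧸ Ideal.span {l} ^ 1) := by
      rw [pow_one, Ideal.Quotient.nontrivial_iff]
      exact fun h => hl.not_isUnit (Ideal.span_singleton_eq_top.1 h)
    exact (AdicCompletion.evalₐ (Ideal.span {l}) 1).toRingHom.domain_nontrivial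
  intro t t' h
  obtain ⟨s, hs⟩ := (IsLocalizedModule.eq_iff_exists
    (nonZeroDivisors (AdicCompletion (Ideal.span {l}) A)) (TensorProduct.mk
    (AdicCompletion (Ideal.span {l}) A) (FractionRing (AdicCompletion (Ideal.span {l}) A))
    (TateModule l M) 1)).1 h
  refine sub_eq_zero.1 (eq_zero_of_smul_eq_zero hl (nonZeroDivisors.ne_zero s.2) ?_)
  rw [smul_sub, sub_eq_zero]
  exact hs

end TateModule

theorem exists_pow_prime_pow_eq_one {E : Type*} [Ring E] (p : ℕ) [Fact p.Prime]
    (hp : (p : E) = 0) {a : E} (ha : IsNilpotent (a - 1)) : ∃ k, a ^ p ^ k = 1 := by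
  obtain ⟨N, hN⟩ := ha
  have hfrob := (Commute.one_right (a - 1)).add_pow_prime_pow_eq (Fact.out : p.Prime) N
  rw [sub_add_cancel, hp, zero_mul, zero_mul, zero_mul, add_zero, one_pow] at hfrob
  refine ⟨N, ?_⟩
  rw [hfrob, pow_eq_zero_of_le (Nat.lt_pow_self (Fact.out : p.Prime).one_lt).le hN, zero_add]

namespace DrinfeldModule

variable {Fq : Type*} [Field Fq] [Finite Fq] {K : Type*} [Field K] [Algebra Fq[X] K]

theorem exists_pow_apply_eq_of_isNilpotent (φ : DrinfeldModule Fq K) (p : ℕ) [Fact p.Prime]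
    [CharP Fq p] {l : Fq[X]} (hl : Prime l)
    (hsurj : ∀ x : φ.Points (SeparableClosure K), ∃ y, l • y = x)
    {σ : Gal(SeparableClosure K/K)} (hσ : IsNilpotent (φ.rationalTateRep l σ - 1)) :
    ∃ k, ∀ x : φ.Points (SeparableClosure K), l • x = 0 → (σ ^ p ^ k) x = x := by
  have hp : (p : Module.End (FractionRing (AdicCompletion (Ideal.span {l}) Fq[X]))
      (RationalTateModule l (φ.Points (SeparableClosure K)))) = 0 := by
    rw [← map_natCast (algebraMap Fq[X] _), CharP.cast_eq_zero, map_zero]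
  obtain ⟨k, hk⟩ := exists_pow_prime_pow_eq_one p hp hσ
  refine ⟨k, fun x hx => ?_⟩
  obtain ⟨t, rfl⟩ := TateModule.exists_apply_one_eq hsurj hx
  rw [← map_pow] at hk
  have hfix := TateModule.one_tmul_injective hl (a₁ := TateModule.map (φ.galoisMap (σ ^ p ^ k)) t)
    (a₂ := t) (LinearMap.congr_fun hk (1 ⊗ₜ t))
  exact congrFun (congrArg Subtype.val hfix) 1

end DrinfeldModule

theorem splits_reverse {L : Type*} [Field L] {P : L[X]} (hP : P.Splits) : P.reverse.Splits := by
  rw [hP.eq_prod_roots]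
  induction P.roots using Multiset.induction_on with
  | empty => simp
  | cons a s ih =>
    rw [Multiset.map_cons, Multiset.prod_cons, mul_left_comm, reverse_mul_of_domain]
    exact (Splits.of_natDegree_le_one
      ((reverse_natDegree_le _).trans (natDegree_X_sub_C_le a))).mul ih

section IsLocalRing

variable {B : Type*} [CommRing B] [IsLocalRing B]

theorem exists_isUnit_isRoot_of_splits [IsDomain B] {P : B[X]} (hs : P.Splits) (hP : P.Monic)
    {k : ℕ} (hk : k < P.natDegree) (hu : IsUnit (P.coeff k)) : ∃ y, IsUnit y ∧ P.IsRoot y := by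
  by_contra! hnon
  have hroot (y : B) (hy : y ∈ P.roots) : IsLocalRing.residue B y = 0 :=
    (IsLocalRing.residue_eq_zero_iff y).2 fun hyu => hnon y hyu (isRoot_of_mem_roots hy)
  have hred : P.map (IsLocalRing.residue B) = X ^ P.natDegree := by
    conv_lhs => rw [hs.eq_prod_roots_of_monic hP]
    rw [Polynomial.map_multiset_prod, Multiset.map_map, hs.natDegree_eq_card_roots,
      ← Multiset.prod_replicate, ← Multiset.map_const']
    exact congrArg _ (Multiset.map_congr rfl fun y hy => by simp [hroot y hy])
  have hcoeff := congrArg (coeff · k) hred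
  rw [coeff_map, coeff_X_pow, if_neg hk.ne] at hcoeff
  exact (IsLocalRing.residue_ne_zero_iff_isUnit _).2 hu hcoeff

theorem exists_isUnit_isRoot_of_splits_map {L : Type*} [Field L] [Algebra B L]
    [IsIntegrallyClosedIn B L] {P : B[X]} (hs : (P.map (algebraMap B L)).Splits)
    (hP : IsUnit P.leadingCoeff) {k : ℕ} (hk : k < P.natDegree) (hu : IsUnit (P.coeff k)) :
    ∃ y, IsUnit y ∧ P.IsRoot y := by
  have : IsDomain B := (IsIntegralClosure.algebraMap_injective B B L).isDomain (algebraMap B L)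
  obtain ⟨v, hv⟩ := hP.exists_left_inv
  have hmonic : (C v * P).Monic := monic_C_mul_of_mul_leadingCoeff_eq_one hv
  have hvu : IsUnit v := IsUnit.of_mul_eq_one _ hv
  have hsplit := splits_of_splits_map_of_isIntegrallyClosedIn (L := L) hmonic <| by
    rw [Polynomial.map_mul, map_C]
    exact (Splits.C _).mul hs
  obtain ⟨y, hy, hroot⟩ := exists_isUnit_isRoot_of_splits hsplit hmonic (k := k)
    (by rwa [natDegree_C_mul hvu.ne_zero]) (by rw [coeff_C_mul]; exact hvu.mul hu)
  rw [IsRoot, eval_mul, eval_C] at hroot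
  exact ⟨y, hy, (mul_eq_zero.1 hroot).resolve_left hvu.ne_zero⟩

end IsLocalRing

theorem natCast_natCard_eq_zero (Fq : Type*) [Field Fq] [Finite Fq] (S : Type*) [CommRing S]
    [Algebra Fq[X] S] : (Nat.card Fq : S) = 0 := by
  have := Fintype.ofFinite Fq
  have h := congrArg ((algebraMap Fq[X] S).comp C) (FiniteField.cast_card_eq_zero Fq)
  rwa [map_natCast, map_zero, ← Nat.card_eq_fintype_card] at h

namespace TwistedPoly

variable {Fq : Type*} [Field Fq] {S : Type*} [CommRing S] [Algebra Fq[X] S]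

/-- The additive polynomial `∑ cₙ X ^ (q ^ n)` attached to `∑ cₙ τⁿ`. -/
def toPolynomial (f : TwistedPoly Fq S) : S[X] :=
  f.toFinsupp.sum fun n a => Polynomial.C a * X ^ Nat.card Fq ^ n

variable [Finite Fq]

theorem coeff_toPolynomial_pow (f : TwistedPoly Fq S) (n : ℕ) :
    f.toPolynomial.coeff (Nat.card Fq ^ n) = f.coeff n := by
  rw [toPolynomial, Finsupp.sum, finsetSum_coeff, Finset.sum_eq_single n]
  · simp
  · intro m _ hmn
    rw [coeff_C_mul_X_pow, if_neg]
    exact fun h => hmn (Nat.pow_right_injective Finite.one_lt_card h.symm)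
  · intro hn
    simpa using hn

theorem coeff_one_toPolynomial (f : TwistedPoly Fq S) : f.toPolynomial.coeff 1 = f.coeff 0 := by
  simpa using f.coeff_toPolynomial_pow 0

theorem coeff_zero_toPolynomial (f : TwistedPoly Fq S) : f.toPolynomial.coeff 0 = 0 := by
  rw [toPolynomial, Finsupp.sum, finsetSum_coeff]
  refine Finset.sum_eq_zero fun n _ => ?_
  rw [coeff_C_mul_X_pow, if_neg (pow_ne_zero n Nat.card_pos.ne').symm]

theorem derivative_toPolynomial (f : TwistedPoly Fq S) :
    derivative f.toPolynomial = Polynomial.C (f.coeff 0) := by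
  rw [toPolynomial, Finsupp.sum, derivative_sum, Finset.sum_eq_single 0]
  · simp
  · intro n _ hn
    rw [derivative_C_mul_X_pow, Nat.cast_pow, natCast_natCard_eq_zero Fq S, zero_pow hn, mul_zero,
      C_0, zero_mul]
  · intro h
    simpa using h

variable {L : Type*} [Field L] [Algebra S L]

theorem separable_map_toPolynomial_sub_C {f : TwistedPoly Fq S}
    (hf : algebraMap S L (f.coeff 0) ≠ 0) (z : L) :
    (f.toPolynomial.map (algebraMap S L) - Polynomial.C z).Separable := by
  rw [Polynomial.Separable, derivative_sub, derivative_C, sub_zero, derivative_map,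
    derivative_toPolynomial, map_C]
  exact ⟨0, Polynomial.C (algebraMap S L (f.coeff 0))⁻¹, by
    rw [zero_mul, zero_add, ← C_mul, inv_mul_cancel₀ hf, C_1]⟩

variable [Algebra Fq[X] L]

theorem evalHom_eq_aeval (f : TwistedPoly Fq S) (x : L) :
    evalHom Fq S L f x = aeval x f.toPolynomial := by
  rw [evalHom_apply, toPolynomial, map_finsuppSum]
  simp only [map_mul, aeval_C, map_pow, aeval_X]
  exact Finset.sum_map _ _ _

theorem evalHom_C (c : S) (x : L) : evalHom Fq S L (C Fq c) x = algebraMap S L c * x := by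
  have hC : (C Fq c : TwistedPoly Fq S).toFinsupp = Finsupp.single 0 c := by
    ext n
    simp [coeff_C, Finsupp.single_apply, eq_comm]
  rw [evalHom_eq_aeval, toPolynomial, hC, Finsupp.sum_single_index (by simp)]
  simp

theorem evalHom_baseChange {S' : Type*} [CommRing S'] [Algebra Fq[X] S'] [Algebra S S']
    [IsScalarTower Fq[X] S S'] [Algebra S' L] [IsScalarTower S S' L] (f : TwistedPoly Fq S)
    (x : L) : evalHom Fq S' L (baseChange S' f) x = evalHom Fq S L f x := by
  have hmap : (baseChange S' f).toPolynomial = f.toPolynomial.map (algebraMap S S') := by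
    change (f.toFinsupp.mapRange (algebraMap S S') (map_zero _)).sum _ = _
    rw [Finsupp.sum_mapRange_index fun n => by simp, toPolynomial, Finsupp.sum, Finsupp.sum,
      Polynomial.map_sum]
    simp
  rw [evalHom_eq_aeval, evalHom_eq_aeval, hmap, aeval_map_algebraMap]

theorem exists_evalHom_eq [IsSepClosed L] {f : TwistedPoly Fq S}
    (hf : algebraMap S L (f.coeff 0) ≠ 0) (z : L) : ∃ x, evalHom Fq S L f x = z := by
  let P := f.toPolynomial.map (algebraMap S L) - Polynomial.C z
  have hcoeff : P.coeff 1 ≠ 0 := by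
    simpa [P, coeff_C, coeff_one_toPolynomial] using hf
  have hdeg : P.degree ≠ 0 := fun h =>
    hcoeff (coeff_eq_zero_of_degree_lt (h ▸ zero_lt_one))
  obtain ⟨x, hx⟩ := IsSepClosed.exists_root P hdeg (separable_map_toPolynomial_sub_C hf z)
  refine ⟨x, ?_⟩
  rw [evalHom_eq_aeval, aeval_def, ← eval_map, ← sub_eq_zero]
  simpa [P] using hx

/-- The inverses of the nonzero roots of `∑ cₙ X ^ (q ^ n)` are the roots of its reverse, whose
leading coefficient is the unit `c₀` and which is not a power of `X` modulo the maximal ideal. -/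
theorem exists_isUnit_evalHom_inv_eq_zero {B : Type*} [CommRing B] [IsLocalRing B]
    [Algebra Fq[X] B] [Algebra B L] [IsIntegrallyClosedIn B L] [IsSepClosed L]
    {f : TwistedPoly Fq B} (h0 : IsUnit (f.coeff 0)) {j : ℕ} (hj : j ≠ 0)
    (hfj : IsUnit (f.coeff j)) :
    ∃ y : B, IsUnit y ∧ evalHom Fq B L f (algebraMap B L y)⁻¹ = 0 := by
  let P := f.toPolynomial
  have hinj : Function.Injective (algebraMap B L) := IsIntegralClosure.algebraMap_injective B B L
  have hP1 : P.coeff 1 = f.coeff 0 := f.coeff_one_toPolynomial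
  have htrail : P.natTrailingDegree = 1 := by
    refine le_antisymm (natTrailingDegree_le_of_ne_zero (hP1 ▸ h0.ne_zero)) ?_
    rw [Nat.one_le_iff_ne_zero, Ne, natTrailingDegree_eq_zero]
    rintro (h | h)
    · rw [h, Polynomial.coeff_zero] at hP1
      exact h0.ne_zero hP1.symm
    · exact h f.coeff_zero_toPolynomial
  have hlead : P.reverse.leadingCoeff = f.coeff 0 := by
    rw [reverse_leadingCoeff, trailingCoeff, htrail, hP1]
  have hsep : (P.map (algebraMap B L)).Separable := by
    simpa using separable_map_toPolynomial_sub_C (h0.map (algebraMap B L)).ne_zero 0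
  have hsplit : (P.reverse.map (algebraMap B L)).Splits := by
    rw [reverse, ← reflect_map, ← natDegree_map_eq_of_injective hinj]
    exact splits_reverse (IsSepClosed.splits_of_separable _ hsep)
  have hjP : P.coeff (Nat.card Fq ^ j) = f.coeff j := f.coeff_toPolynomial_pow j
  have hjdeg : Nat.card Fq ^ j ≤ P.natDegree := le_natDegree_of_ne_zero (hjP ▸ hfj.ne_zero)
  have hjone : 1 < Nat.card Fq ^ j := Nat.one_lt_pow hj Finite.one_lt_card
  obtain ⟨y, hy, hroot⟩ := exists_isUnit_isRoot_of_splits_map hsplit (hlead ▸ h0)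
    (k := P.natDegree - Nat.card Fq ^ j) (by rw [reverse_natDegree, htrail]; omega)
    (by rwa [coeff_reverse, revAt_le (Nat.sub_le _ _), Nat.sub_sub_self hjdeg, hjP])
  have hy0 : (algebraMap B L y)⁻¹ ≠ 0 := inv_ne_zero (hy.map _).ne_zero
  let := invertibleOfNonzero hy0
  refine ⟨y, hy, ?_⟩
  rw [evalHom_eq_aeval, aeval_def, ← eval₂_reverse_eq_zero_iff, invOf_eq_inv, inv_inv,
    eval₂_at_apply, hroot, map_zero]

end TwistedPoly

namespace DrinfeldModule

variable {Fq : Type*} [Field Fq] [Finite Fq] {K : Type*} [Field K] [Algebra Fq[X] K]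

theorem exists_smul_eq (φ : DrinfeldModule Fq K) {L : Type*} [Field L] [Algebra Fq[X] L]
    [Algebra K L] [IsSepClosed L] {l : Fq[X]} (hl : algebraMap Fq[X] K l ≠ 0) (z : φ.Points L) :
    ∃ x, l • x = z :=
  TwistedPoly.exists_evalHom_eq (L := L) (by rwa [φ.coeff_zero, _root_.map_ne_zero]) z

theorem hasDegree_toRingHom (φ : DrinfeldModule Fq K) {a : Fq[X]} (ha : a ≠ 0) :
    (φ.toRingHom a).HasDegree (φ.rank * a.natDegree) := by
  rw [φ.toRingHom_apply]
  exact φ.hasDegree_X.aeval φ.one_le_rank ha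

theorem StableModel.exists_isUnit_evalHom_inv_eq_zero [IsSepClosed K] {R : Type*} [CommRing R]
    [IsLocalRing R] [Algebra Fq[X] R] [Algebra R K] [IsScalarTower Fq[X] R K]
    [IsIntegrallyClosedIn R K] {φ : DrinfeldModule Fq K} (M : φ.StableModel R) {l : Fq[X]}
    (hl : IsUnit (algebraMap Fq[X] R l)) (hdeg : l.natDegree ≠ 0) :
    ∃ y : R, IsUnit y ∧ TwistedPoly.evalHom Fq K K (φ.toRingHom l) (algebraMap R K y)⁻¹ = 0 := by
  have hconst : (M.toRingHom l).coeff 0 = algebraMap Fq[X] R l :=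
    IsIntegralClosure.algebraMap_injective R R K <| by
      rw [← TwistedPoly.coeff_baseChange, M.baseChange_toRingHom, φ.coeff_zero,
        ← IsScalarTower.algebraMap_apply]
  have hl0 : l ≠ 0 := fun h => hdeg (by rw [h, natDegree_zero])
  have hred := (M.reduction.hasDegree_toRingHom hl0).1
  rw [M.reduction_toRingHom] at hred
  obtain ⟨y, hy, hroot⟩ := TwistedPoly.exists_isUnit_evalHom_inv_eq_zero (L := K)
    (hconst ▸ hl) (mul_ne_zero (Nat.one_le_iff_ne_zero.1 M.reduction.one_le_rank) hdeg)
    ((IsLocalRing.residue_ne_zero_iff_isUnit _).1 hred)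
  exact ⟨y, hy, by rw [← M.baseChange_toRingHom, TwistedPoly.evalHom_baseChange, hroot]⟩

theorem evalHom_toRingHom_mul (φ : DrinfeldModule Fq K) (c : Kˣ) (a : Fq[X]) (x : K) :
    TwistedPoly.evalHom Fq K K (φ.toRingHom a) (c * x) =
      c * TwistedPoly.evalHom Fq K K ((φ.twist c).toRingHom a) x := by
  have h := congrArg (TwistedPoly.evalHom Fq K K · x) (φ.C_mul_twist c a)
  simp only [map_mul, AddMonoid.End.coe_mul, Function.comp_apply, TwistedPoly.evalHom_C,
    Algebra.algebraMap_self, RingHom.id_apply] at h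
  exact h.symm

end DrinfeldModule

theorem eq_one_of_pow_eq_one_of_sub_one_mem {B : Type*} [CommRing B] [IsLocalRing B] [IsDomain B]
    {n : ℕ} (hn : IsUnit (n : B)) {ζ : B} (hζ : ζ ^ n = 1)
    (h : ζ - 1 ∈ IsLocalRing.maximalIdeal B) : ζ = 1 := by
  have hres : IsLocalRing.residue B ζ = 1 := by
    rwa [← IsLocalRing.residue_eq_zero_iff, map_sub, map_one, sub_eq_zero] at h
  have hunit : IsUnit (∑ i ∈ Finset.range n, ζ ^ i) := by
    rw [← IsLocalRing.residue_ne_zero_iff_isUnit] at hn ⊢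
    simpa [hres] using hn
  refine sub_eq_zero.1 ((mul_eq_zero.1 ?_).resolve_left hunit.ne_zero)
  rw [geom_sum_mul, hζ, sub_self]

theorem algEquiv_pow_apply_eq_pow_mul {R A : Type*} [CommSemiring R] [Semiring A] [Algebra R A]
    {σ : A ≃ₐ[R] A} {ζ c : A} (hζ : σ ζ = ζ) (hc : σ c = ζ * c) (m : ℕ) :
    (σ ^ m) c = ζ ^ m * c := by
  induction m with
  | zero => simp
  | succ m ih =>
    rw [pow_succ', AlgEquiv.mul_apply, ih, map_mul, map_pow, hζ, hc, pow_succ, mul_assoc]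

section Inertia

variable {K : Type*} [Field K] [ValuativeRel K] [TopologicalSpace K] [IsNonarchimedeanLocalField K]
  {n : ℕ} (hn : IsUnit (n : integralClosure 𝒪[K] (SeparableClosure K)))
  {σ : Gal(SeparableClosure K/K)} (hσ : σ ∈ inertiaGroup K)

include hn hσ

theorem eq_one_of_inertia_apply_eq_mul {x : integralClosure 𝒪[K] (SeparableClosure K)}
    (hx : IsUnit x) {η : SeparableClosure K} (hη : η ^ n = 1)
    (h : σ (x : SeparableClosure K) = η * x) : η = 1 := by
  have hn0 : 0 < n := Nat.pos_of_ne_zero fun h0 => hn.ne_zero (by rw [h0, Nat.cast_zero])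
  have hint : IsIntegral 𝒪[K] η := .of_pow hn0 (hη ▸ isIntegral_one)
  refine congrArg Subtype.val (eq_one_of_pow_eq_one_of_sub_one_mem hn (ζ := ⟨η, hint⟩)
    (Subtype.ext hη) ?_)
  have hmem : σ • x - x = (⟨η, hint⟩ - 1) * x := by
    rw [sub_mul, one_mul]
    exact congrArg (· - x) (Subtype.ext h)
  exact (Ideal.mul_unit_mem_iff_mem _ hx).1 (hmem ▸ mem_inertiaGroup_iff.1 hσ x)

theorem inertia_apply_eq_self_of_pow_eq_one {ζ : SeparableClosure K} (hζ : ζ ^ n = 1) :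
    σ ζ = ζ := by
  have hn0 : n ≠ 0 := fun h0 => hn.ne_zero (by rw [h0, Nat.cast_zero])
  have hζ0 : ζ ≠ 0 := by
    rintro rfl
    exact zero_ne_one ((zero_pow hn0).symm.trans hζ)
  have hint : IsIntegral 𝒪[K] ζ := .of_pow (Nat.pos_of_ne_zero hn0) (hζ ▸ isIntegral_one)
  refine (div_eq_one_iff_eq hζ0).1 (eq_one_of_inertia_apply_eq_mul hn hσ (x := ⟨ζ, hint⟩)
    (IsUnit.of_pow_eq_one (Subtype.ext hζ) hn0) ?_ (div_mul_cancel₀ _ hζ0).symm)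
  rw [div_pow, ← map_pow, hζ, map_one, div_one]

variable {c : SeparableClosure K} {g : K} (hc : c ^ n = algebraMap K (SeparableClosure K) g)
  (hc0 : c ≠ 0) {y : integralClosure 𝒪[K] (SeparableClosure K)} (hy : IsUnit y)

include hc hc0 hy

theorem inertia_apply_eq_self_of_apply_mul_inv_eq
    (hfix : σ (c * (y : SeparableClosure K)⁻¹) = c * (y : SeparableClosure K)⁻¹) : σ c = c := by
  have hy0 : (y : SeparableClosure K) ≠ 0 := fun h => hy.ne_zero (Subtype.ext h)
  have hσy0 : σ (y : SeparableClosure K) ≠ 0 := (_root_.map_ne_zero σ).2 hy0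
  have hηn : (σ c / c) ^ n = 1 := by
    rw [div_pow, ← map_pow, hc, AlgEquiv.commutes, ← hc, div_self (pow_ne_zero n hc0)]
  refine (div_eq_one_iff_eq hc0).1 (eq_one_of_inertia_apply_eq_mul hn hσ hy hηn ?_)
  rw [map_mul, map_inv₀] at hfix
  field_simp at hfix ⊢
  linear_combination -hfix

/-- The tame character `σ ↦ σ c / c` has order prime to `p`, so it is trivial as soon as its
`p`-power is. -/
theorem inertia_apply_eq_self_of_pow_apply_mul_inv_eq (p : ℕ) [Fact p.Prime] [CharP K p] {k : ℕ}
    (hfix : (σ ^ p ^ k) (c * (y : SeparableClosure K)⁻¹) = c * (y : SeparableClosure K)⁻¹) :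
    σ c = c := by
  have : CharP (SeparableClosure K) p :=
    charP_of_injective_algebraMap (algebraMap K (SeparableClosure K)).injective p
  have hζn : (σ c / c) ^ n = 1 := by
    rw [div_pow, ← map_pow, hc, AlgEquiv.commutes, ← hc, div_self (pow_ne_zero n hc0)]
  have hpow := algEquiv_pow_apply_eq_pow_mul (inertia_apply_eq_self_of_pow_eq_one hn hσ hζn)
    (div_mul_cancel₀ _ hc0).symm (p ^ k)
  rw [inertia_apply_eq_self_of_apply_mul_inv_eq hn (pow_mem hσ _) hc hc0 hy hfix, eq_comm,
    mul_eq_right₀ hc0] at hpow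
  refine (div_eq_one_iff_eq hc0).1 (sub_eq_zero.1 (eq_zero_of_pow_eq_zero (n := p ^ k) ?_))
  rw [sub_pow_char_pow, hpow, one_pow, sub_self]

end Inertia

theorem exists_forall_pow_le_pow {ι Γ : Type*} [LinearOrderedCommGroupWithZero Γ] {s : Finset ι}
    (hs : s.Nonempty) (f : ι → Γ) {n : ι → ℕ} (hn : ∀ i ∈ s, n i ≠ 0) :
    ∃ j ∈ s, ∀ i ∈ s, f i ^ n j ≤ f j ^ n i := by
  classical
  let e := ∏ i ∈ s, n i
  let m (i : ι) := ∏ k ∈ s.erase i, n k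
  have hm {i : ι} (hi : i ∈ s) : n i * m i = e := Finset.mul_prod_erase s n hi
  obtain ⟨j, hj, hmax⟩ := s.exists_max_image (fun i => f i ^ m i) hs
  refine ⟨j, hj, fun i hi => ?_⟩
  refine (pow_le_pow_iff_left₀ zero_le zero_le (Finset.prod_ne_zero_iff.2 hn : e ≠ 0)).1 ?_
  calc (f i ^ n j) ^ e = (f i ^ m i) ^ (n i * n j) := by
        rw [← pow_mul, ← pow_mul, ← hm hi]
        ring_nf
    _ ≤ (f j ^ m j) ^ (n i * n j) := pow_le_pow_left' (hmax i hi) _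
    _ = (f j ^ n i) ^ e := by
        rw [← pow_mul, ← pow_mul, ← hm hj]
        ring_nf

theorem natCard_pow_sub_one_ne_zero (α : Type*) [Finite α] [Nontrivial α] {i : ℕ} (hi : 1 ≤ i) :
    Nat.card α ^ i - 1 ≠ 0 :=
  (Nat.sub_pos_of_lt (Nat.one_lt_pow (by omega) Finite.one_lt_card)).ne'

theorem isUnit_natCard_pow_sub_one (Fq : Type*) [Field Fq] [Finite Fq] (S : Type*) [CommRing S]
    [Algebra Fq[X] S] {i : ℕ} (hi : 1 ≤ i) : IsUnit ((Nat.card Fq ^ i - 1 : ℕ) : S) := by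
  rw [Nat.cast_sub (Nat.one_le_pow _ _ Nat.card_pos), Nat.cast_pow, natCast_natCard_eq_zero Fq,
    zero_pow (by omega), Nat.cast_one, zero_sub]
  exact isUnit_one.neg

theorem charP_of_algebra_polynomial (F K : Type*) [Field F] [Field K] [Algebra F[X] K] (p : ℕ)
    [CharP F p] : CharP K p :=
  charP_of_injective_ringHom (f := (algebraMap F[X] K).comp C) (RingHom.injective _) p

theorem isUnit_algebraMap_of_span_ne_ker {A R : Type*} [CommRing A] [IsDomain A]
    [IsPrincipalIdealRing A] [CommRing R] [IsLocalRing R] [Algebra A R] {l : A} (hl : Prime l)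
    (h : Ideal.span {l} ≠ RingHom.ker (algebraMap A (IsLocalRing.ResidueField R))) :
    IsUnit (algebraMap A R l) := by
  have : (Ideal.span {l}).IsMaximal :=
    PrincipalIdealRing.isMaximal_of_irreducible hl.irreducible
  by_contra hlu
  refine h (this.eq_of_le (RingHom.ker_ne_top _) ((Ideal.span_singleton_le_iff_mem _).2 ?_))
  exact (IsLocalRing.residue_eq_zero_iff (algebraMap A R l)).2 hlu

namespace DrinfeldModule

variable {Fq : Type*} [Field Fq] [Finite Fq] {K : Type*} [Field K] [Algebra Fq[X] K]

section IsDominantIndex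

variable {Γ₀ : Type*} [LinearOrderedCommGroupWithZero Γ₀]

/-- Writing `φ_X = ∑ gᵢ τⁱ`, the index `j` maximizes `v(gᵢ) ^ (1 / (qⁱ - 1))` over `i ≥ 1`. The
roots are cleared from the inequality, whose case `i = 0` says `v(g₀) ≤ 1`. -/
structure IsDominantIndex (φ : DrinfeldModule Fq K) (v : Valuation K Γ₀) (j : ℕ) : Prop where
  one_le : 1 ≤ j
  coeff_ne_zero : (φ.toRingHom X).coeff j ≠ 0
  pow_le_pow : ∀ i, v ((φ.toRingHom X).coeff i) ^ (Nat.card Fq ^ j - 1) ≤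
    v ((φ.toRingHom X).coeff j) ^ (Nat.card Fq ^ i - 1)

theorem exists_isDominantIndex (φ : DrinfeldModule Fq K) {v : Valuation K Γ₀}
    (hv : v (algebraMap Fq[X] K X) ≤ 1) : ∃ j, φ.IsDominantIndex v j := by
  have hr : φ.rank ∈ Finset.Icc 1 φ.rank := Finset.mem_Icc.2 ⟨φ.one_le_rank, le_rfl⟩
  obtain ⟨j, hj, hmax⟩ := exists_forall_pow_le_pow ⟨_, hr⟩ (fun i => v ((φ.toRingHom X).coeff i))
    (n := fun i => Nat.card Fq ^ i - 1)
    fun i hi => natCard_pow_sub_one_ne_zero Fq (Finset.mem_Icc.1 hi).1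
  have hj1 : 1 ≤ j := (Finset.mem_Icc.1 hj).1
  refine ⟨j, hj1, fun hj0 => ?_, fun i => ?_⟩
  · have hle := hmax _ hr
    rw [hj0, map_zero, zero_pow (natCard_pow_sub_one_ne_zero Fq φ.one_le_rank), le_zero_iff] at hle
    exact φ.coeff_rank_ne_zero (v.zero_iff.1 (eq_zero_of_pow_eq_zero hle))
  · rcases Nat.eq_zero_or_pos i with rfl | hi
    · rw [φ.coeff_zero, pow_zero, Nat.sub_self, pow_zero]
      exact pow_le_one₀ zero_le hv
    rcases le_or_gt i φ.rank with hir | hir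
    · exact hmax i (Finset.mem_Icc.2 ⟨hi, hir⟩)
    · rw [φ.hasDegree_X.2 i hir, map_zero, zero_pow (natCard_pow_sub_one_ne_zero Fq hj1)]
      exact zero_le

variable {φ : DrinfeldModule Fq K} {v : Valuation K Γ₀} {j : ℕ} {R : Type*} [CommRing R]
  [Algebra Fq[X] R] [Algebra R K]

theorem IsDominantIndex.pow_mul_inv_pow_le_one (h : φ.IsDominantIndex v j) (i : ℕ) :
    v ((φ.toRingHom X).coeff i) ^ (Nat.card Fq ^ j - 1) *
      (v ((φ.toRingHom X).coeff j))⁻¹ ^ (Nat.card Fq ^ i - 1) ≤ 1 := by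
  rw [inv_pow]
  exact mul_inv_le_one_of_le₀ (h.pow_le_pow i) zero_le

theorem IsDominantIndex.nonempty_stableModel_twist [IsScalarTower Fq[X] R K] [IsLocalRing R]
    (h : φ.IsDominantIndex v j) (hv : v.Integers R) {d : Kˣ}
    (hd : v d ^ (Nat.card Fq ^ j - 1) = (v ((φ.toRingHom X).coeff j))⁻¹) :
    Nonempty ((φ.twist d).StableModel R) := by
  have hn : Nat.card Fq ^ j - 1 ≠ 0 := natCard_pow_sub_one_ne_zero Fq h.one_le
  have hcoeff (i : ℕ) : v (((φ.twist d).toRingHom X).coeff i) =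
      v ((φ.toRingHom X).coeff i) * v d ^ (Nat.card Fq ^ i - 1) := by
    rw [twist_toRingHom_X, TwistedPoly.coeff_conj, map_mul, map_pow]
  have hint (i : ℕ) : ((φ.twist d).toRingHom X).coeff i ∈ (algebraMap R K).range := by
    refine hv.exists_of_le_one ((pow_le_one_iff_of_nonneg zero_le hn).1 ?_)
    rw [hcoeff, mul_pow, pow_right_comm, hd]
    exact h.pow_mul_inv_pow_le_one i
  obtain ⟨y, hy⟩ := hint j
  refine nonempty_stableModel_of_coeff_mem_range hv.hom_inj hint h.one_le
    (hv.isUnit_iff_valuation_eq_one.2 ?_) hy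
  rw [hy, hcoeff, hd, mul_inv_cancel₀ ((Valuation.ne_zero_iff v).2 h.coeff_ne_zero)]

variable {L : Type*} [Field L] [Algebra Fq[X] L] [Algebra K L] [IsScalarTower Fq[X] K L]
  [Algebra R L] [IsScalarTower R K L] [IsScalarTower Fq[X] R L]
  [IsLocalRing (integralClosure R L)] {c : Lˣ}

theorem IsDominantIndex.nonempty_stableModel_twist_baseChange (h : φ.IsDominantIndex v j)
    (hv : v.Integers R) (hc : (c : L) ^ (Nat.card Fq ^ j - 1) =
      algebraMap K L ((φ.toRingHom X).coeff j)⁻¹) :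
    Nonempty (((φ.baseChange L).twist c).StableModel (integralClosure R L)) := by
  have hn : 0 < Nat.card Fq ^ j - 1 :=
    Nat.pos_of_ne_zero (natCard_pow_sub_one_ne_zero Fq h.one_le)
  have hcoeff (i : ℕ) : (((φ.baseChange L).twist c).toRingHom X).coeff i =
      algebraMap K L ((φ.toRingHom X).coeff i) * (c : L) ^ (Nat.card Fq ^ i - 1) := by
    rw [twist_toRingHom_X, TwistedPoly.coeff_conj, baseChange_toRingHom,
      TwistedPoly.coeff_baseChange]
  have hint (i : ℕ) : IsIntegral R ((((φ.baseChange L).twist c).toRingHom X).coeff i) := by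
    refine .of_pow hn ?_
    rw [hcoeff, mul_pow, pow_right_comm, hc, ← map_pow, ← map_pow, ← map_mul]
    obtain ⟨a, ha⟩ := hv.exists_of_le_one (r := (φ.toRingHom X).coeff i ^ (Nat.card Fq ^ j - 1) *
      ((φ.toRingHom X).coeff j)⁻¹ ^ (Nat.card Fq ^ i - 1)) <| by
        simpa only [map_mul, map_pow, map_inv₀] using h.pow_mul_inv_pow_le_one i
    rw [← ha, ← IsScalarTower.algebraMap_apply]
    exact isIntegral_algebraMap
  refine nonempty_stableModel_of_coeff_mem_range Subtype.val_injective
    (fun i => ⟨⟨_, hint i⟩, rfl⟩) h.one_le isUnit_one ?_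
  rw [map_one, hcoeff, hc, ← map_mul, mul_inv_cancel₀ h.coeff_ne_zero, map_one]

theorem IsDominantIndex.exists_isUnit_evalHom_mul_inv_eq_zero [IsSepClosed L]
    (h : φ.IsDominantIndex v j) (hv : v.Integers R)
    (hc : (c : L) ^ (Nat.card Fq ^ j - 1) = algebraMap K L ((φ.toRingHom X).coeff j)⁻¹)
    {l : Fq[X]} (hl : IsUnit (algebraMap Fq[X] R l)) (hdeg : l.natDegree ≠ 0) :
    ∃ y : integralClosure R L, IsUnit y ∧
      TwistedPoly.evalHom Fq K L (φ.toRingHom l) (c * (y : L)⁻¹) = 0 := by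
  obtain ⟨M⟩ := h.nonempty_stableModel_twist_baseChange hv hc
  have hlB : IsUnit (algebraMap Fq[X] (integralClosure R L) l) := by
    rw [IsScalarTower.algebraMap_apply Fq[X] R]
    exact hl.map _
  obtain ⟨y, hy, hroot⟩ := M.exists_isUnit_evalHom_inv_eq_zero hlB hdeg
  refine ⟨y, hy, ?_⟩
  rw [← TwistedPoly.evalHom_baseChange (S' := L), ← baseChange_toRingHom, evalHom_toRingHom_mul]
  exact mul_eq_zero_of_right _ hroot

end IsDominantIndex

section LocalField

variable [ValuativeRel K] [TopologicalSpace K] [IsNonarchimedeanLocalField K]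
  [Algebra Fq[X] 𝒪[K]] [IsScalarTower Fq[X] 𝒪[K] K]

theorem IsDominantIndex.inertia_apply_eq_self {φ : DrinfeldModule Fq K} {j : ℕ}
    (h : φ.IsDominantIndex (valuation K) j) (p : ℕ) [Fact p.Prime] [CharP Fq p] {l : Fq[X]}
    (hl : Prime l) (hlu : IsUnit (algebraMap Fq[X] 𝒪[K] l)) {c : (SeparableClosure K)ˣ}
    (hc : (c : SeparableClosure K) ^ (Nat.card Fq ^ j - 1) =
      algebraMap K (SeparableClosure K) ((φ.toRingHom X).coeff j)⁻¹)
    {σ : Gal(SeparableClosure K/K)} (hσ : σ ∈ inertiaGroup K)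
    (hunip : IsNilpotent (φ.rationalTateRep l σ - 1)) : σ c = c := by
  have : CharP K p := charP_of_algebra_polynomial Fq K p
  have : IsScalarTower Fq[X] 𝒪[K] (SeparableClosure K) := .of_algebraMap_eq fun a => by
    rw [IsScalarTower.algebraMap_apply 𝒪[K] K, ← IsScalarTower.algebraMap_apply Fq[X] 𝒪[K] K,
      ← IsScalarTower.algebraMap_apply]
  have hlK : algebraMap Fq[X] K l ≠ 0 := by
    rw [IsScalarTower.algebraMap_apply Fq[X] 𝒪[K] K]
    exact (hlu.map (algebraMap 𝒪[K] K)).ne_zero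
  have hn : IsUnit ((Nat.card Fq ^ j - 1 : ℕ) : integralClosure 𝒪[K] (SeparableClosure K)) := by
    rw [← map_natCast (algebraMap 𝒪[K] (integralClosure 𝒪[K] (SeparableClosure K)))]
    exact (isUnit_natCard_pow_sub_one Fq 𝒪[K] h.one_le).map _
  obtain ⟨y, hy, hroot⟩ := h.exists_isUnit_evalHom_mul_inv_eq_zero
    (Valuation.integer.integers (valuation K)) hc hlu hl.irreducible.natDegree_pos.ne'
  obtain ⟨k, hk⟩ := φ.exists_pow_apply_eq_of_isNilpotent p hl (φ.exists_smul_eq hlK) hunip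
  exact inertia_apply_eq_self_of_pow_apply_mul_inv_eq hn hσ hc c.ne_zero hy p (hk _ hroot)

theorem hasStableReduction_of_isNilpotent (φ : DrinfeldModule Fq K) {l : Fq[X]} (hl : Prime l)
    (hlu : IsUnit (algebraMap Fq[X] 𝒪[K] l))
    (hunip : ∀ σ ∈ inertiaGroup K, IsNilpotent (φ.rationalTateRep l σ - 1)) :
    φ.HasStableReduction := by
  obtain ⟨p, hp⟩ := CharP.exists Fq
  have : Fact p.Prime := ⟨CharP.char_is_prime Fq p⟩
  have : CharP K p := charP_of_algebra_polynomial Fq K p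
  have hv : (valuation K).Integers 𝒪[K] := Valuation.integer.integers (valuation K)
  obtain ⟨j, h⟩ := φ.exists_isDominantIndex (v := valuation K) <| by
    rw [IsScalarTower.algebraMap_apply Fq[X] 𝒪[K] K]
    exact hv.map_le_one _
  have hn := isUnit_natCard_pow_sub_one Fq (SeparableClosure K) h.one_le
  have : NeZero ((Nat.card Fq ^ j - 1 : ℕ) : SeparableClosure K) := ⟨hn.ne_zero⟩
  have hg : ((φ.toRingHom X).coeff j)⁻¹ ≠ 0 := inv_ne_zero h.coeff_ne_zero
  have hn0 : Nat.card Fq ^ j - 1 ≠ 0 := natCard_pow_sub_one_ne_zero Fq h.one_le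
  obtain ⟨c, hc⟩ := IsSepClosed.exists_pow_nat_eq
    (algebraMap K (SeparableClosure K) ((φ.toRingHom X).coeff j)⁻¹) (Nat.card Fq ^ j - 1)
  have hc0 : c ≠ 0 := by
    rw [← pow_ne_zero_iff hn0, hc]
    exact (_root_.map_ne_zero _).2 hg
  obtain ⟨d, hd⟩ := exists_valuation_pow_eq_of_inertiaGroup_fixes p hn.ne_zero hg hc
    fun σ hσ => h.inertia_apply_eq_self p hl hlu (c := Units.mk0 c hc0) hc hσ (hunip σ hσ)
  have hd0 : d ≠ 0 := by
    rw [← (valuation K).ne_zero_iff, ← pow_ne_zero_iff hn0, hd]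
    exact (valuation K).ne_zero_iff.2 hg
  exact hasStableReduction_of_twist
    (h.nonempty_stableModel_twist hv (d := Units.mk0 d hd0) (hd.trans (map_inv₀ _ _)))

end LocalField

end DrinfeldModule

end

theorem proposition2p5
    {Fq : Type*} [Field Fq] [Finite Fq]
    {K : Type*} [Field K] [ValuativeRel K] [TopologicalSpace K] [IsNonarchimedeanLocalField K]
    [Algebra Fq[X] K] [Algebra Fq[X] 𝒪[K]] [IsScalarTower Fq[X] 𝒪[K] K]
    (φ ψ : DrinfeldModule Fq K) (u : TwistedPoly Fq K) (hu : φ.IsIsogeny ψ u)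
    (l : Fq[X]) (hl : Prime l)
    (hchar : Ideal.span {l} ≠ RingHom.ker (algebraMap Fq[X] 𝓀[K]))
    (hunip : ∀ σ ∈ inertiaGroup K, IsNilpotent (φ.rationalTateRep l σ - 1)) :
    ψ.HasStableReduction :=
  (φ.hasStableReduction_of_isNilpotent hl (isUnit_algebraMap_of_span_ne_ker hl hchar)
    hunip).of_isIsogeny hu
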